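/- Let $M$ be a compact (Hausdorff) smooth manifold without boundary of dimension $n\ge 3$, let $p\in\mathbb R$ with $p>n/2$, and let $\gamma$ be a Riemannian metric on $M$ of class $W^p_2$, i.e. a continuous, everywhere positive definite metric whose components in charts have weak derivatives of order $\le 2$ in $L^p_{\rm loc}$. Let $R(\gamma)$ be its scalar curvature (an almost everywhere defined function), put $r=\frac{n-2}{4(n-1)}R(\gamma)$, and let $a,b,q_1,q_2\in L^1(M)$ be non-negative almost everywhere. (Inequalities and equalities between functions are meant almost everywhere. For a function $h\ge 0$ defined almost everywhere, $h\not\equiv 0$ means that there is a nonempty open set on which the essential infimum of $h$ is positive.) Suppose that one of the following holds: 1. $r\le 0$, $b-q_2\le 0$ and $-r+a+q_1-b+q_2\not\equiv 0$; 2. $r\ge 0$, $a\equiv q_1\equiv 0$, $b-q_2\ge 0$ and $r+b-q_2\not\equiv 0$. Then the Lichnerowicz equation $$\Delta_\gamma\varphi = r\varphi - a\,\varphi^{-\frac{3n-2}{n-2}} - q_1\,\varphi^{-\frac{n}{n-2}} + (b-q_2)\,\varphi^{\frac{n+2}{n-2}}$$ has no solution $\varphi\in W^p_2(M)$ with $\varphi>0$.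 -/

import Mathlib

open Set MeasureTheory Bundle
open scoped Manifold ContDiff ENNReal

noncomputable section

/-! ### Weak derivatives and local Sobolev spaces on open subsets of Euclidean space -/

/-- `v` is a weak `i`-th partial derivative of `u` on the open set `Ω`: both functions are locally
integrable on `Ω` and `∫ u ∂ᵢψ = - ∫ v ψ` for every test function `ψ ∈ C_c^∞(Ω)`. -/
def IsWeakPartial {n : ℕ} (Ω : Set (EuclideanSpace ℝ (Fin n))) (i : Fin n)
    (u v : EuclideanSpace ℝ (Fin n) → ℝ) : Prop :=
  LocallyIntegrableOn u Ω volume ∧ LocallyIntegrableOn v Ω volume ∧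
    ∀ ψ : EuclideanSpace ℝ (Fin n) → ℝ, ContDiff ℝ ∞ ψ → HasCompactSupport ψ → tsupport ψ ⊆ Ω →
      ∫ y in Ω, u y * fderiv ℝ ψ y (EuclideanSpace.single i 1) = - ∫ y in Ω, v y * ψ y

open Classical in
/-- The weak partial derivative `∂ᵢ u` on `Ω`. It is determined up to a null subset of `Ω`; this
picks a representative (and is `0` if `u` has no weak `i`-th partial derivative on `Ω`). -/
def weakPartial {n : ℕ} (Ω : Set (EuclideanSpace ℝ (Fin n))) (i : Fin n)
    (u : EuclideanSpace ℝ (Fin n) → ℝ) : EuclideanSpace ℝ (Fin n) → ℝ :=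
  if h : ∃ v, IsWeakPartial Ω i u v then h.choose else 0

/-- `u ∈ L^p_loc(Ω)`. -/
def MemLpLoc {n : ℕ} (Ω : Set (EuclideanSpace ℝ (Fin n))) (p : ℝ)
    (u : EuclideanSpace ℝ (Fin n) → ℝ) : Prop :=
  ∀ K ⊆ Ω, IsCompact K → MemLp u (ENNReal.ofReal p) (volume.restrict K)

/-- `u` belongs to the local Sobolev space of functions with weak derivatives of order `≤ 2` in
`L^p_loc(Ω)`. -/
structure MemW2Loc {n : ℕ} (Ω : Set (EuclideanSpace ℝ (Fin n))) (p : ℝ)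
    (u : EuclideanSpace ℝ (Fin n) → ℝ) : Prop where
  memLp : MemLpLoc Ω p u
  exists_first : ∀ i, ∃ v, IsWeakPartial Ω i u v
  memLp_first : ∀ i, MemLpLoc Ω p (weakPartial Ω i u)
  exists_second : ∀ i j, ∃ v, IsWeakPartial Ω j (weakPartial Ω i u) v
  memLp_second : ∀ i j, MemLpLoc Ω p (weakPartial Ω j (weakPartial Ω i u))

/-! ### Riemannian geometry in coordinates, with weak derivatives -/

/-- Christoffel symbols
`Γ^k_{ij} = ½ g^{kl} (∂_i g_{jl} + ∂_j g_{il} - ∂_l g_{ij})` of the matrix of components `g`. -/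
def coordChristoffel {n : ℕ} (Ω : Set (EuclideanSpace ℝ (Fin n)))
    (g : EuclideanSpace ℝ (Fin n) → Matrix (Fin n) (Fin n) ℝ) (k i j : Fin n)
    (y : EuclideanSpace ℝ (Fin n)) : ℝ :=
  (1 / 2) * ∑ l, (g y)⁻¹ k l *
    (weakPartial Ω i (fun z => g z j l) y + weakPartial Ω j (fun z => g z i l) y
      - weakPartial Ω l (fun z => g z i j) y)

/-- Laplace operator on functions, `Δ_g u = g^{ij} (∂_i ∂_j u - Γ^k_{ij} ∂_k u)`. -/
def coordLaplacian {n : ℕ} (Ω : Set (EuclideanSpace ℝ (Fin n)))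
    (g : EuclideanSpace ℝ (Fin n) → Matrix (Fin n) (Fin n) ℝ)
    (u : EuclideanSpace ℝ (Fin n) → ℝ) (y : EuclideanSpace ℝ (Fin n)) : ℝ :=
  ∑ i, ∑ j, (g y)⁻¹ i j *
    (weakPartial Ω i (weakPartial Ω j u) y
      - ∑ k, coordChristoffel Ω g k i j y * weakPartial Ω k u y)

/-- Ricci tensor
`R_{jk} = ∂_i Γ^i_{jk} - ∂_k Γ^i_{ij} + Γ^i_{il} Γ^l_{jk} - Γ^i_{kl} Γ^l_{ij}`
(positive on round spheres). -/
def coordRicci {n : ℕ} (Ω : Set (EuclideanSpace ℝ (Fin n)))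
    (g : EuclideanSpace ℝ (Fin n) → Matrix (Fin n) (Fin n) ℝ) (j k : Fin n)
    (y : EuclideanSpace ℝ (Fin n)) : ℝ :=
  ∑ i, (weakPartial Ω i (coordChristoffel Ω g i j k) y
    - weakPartial Ω k (coordChristoffel Ω g i i j) y
    + ∑ l, (coordChristoffel Ω g i i l y * coordChristoffel Ω g l j k y
      - coordChristoffel Ω g i k l y * coordChristoffel Ω g l i j y))

/-- Scalar curvature `g^{jk} R_{jk}`. -/
def coordScalarCurvature {n : ℕ} (Ω : Set (EuclideanSpace ℝ (Fin n)))
    (g : EuclideanSpace ℝ (Fin n) → Matrix (Fin n) (Fin n) ℝ)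
    (y : EuclideanSpace ℝ (Fin n)) : ℝ :=
  ∑ j, ∑ k, (g y)⁻¹ j k * coordRicci Ω g j k y

/-! ### The same notions on an `n`-dimensional manifold without boundary -/

section Manifold

variable {n : ℕ} {M : Type*} [TopologicalSpace M] [ChartedSpace (EuclideanSpace ℝ (Fin n)) M]

/-- The property `P` holds at almost every point of `M`, that is, almost everywhere for Lebesgue
measure in every chart of the atlas. -/
def ManifoldAE (n : ℕ) {M : Type*} [TopologicalSpace M]
    [ChartedSpace (EuclideanSpace ℝ (Fin n)) M] (P : M → Prop) : Prop :=
  ∀ e ∈ atlas (EuclideanSpace ℝ (Fin n)) M,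
    ∀ᵐ y ∂(volume.restrict e.target), P (e.symm y)

/-- `f ∈ L¹(M)` for compact `M`: on a compact manifold this is local integrability in charts (for
Lebesgue measure, or equivalently for the volume of any continuous Riemannian metric). -/
def ManifoldMemL1 (n : ℕ) {M : Type*} [TopologicalSpace M]
    [ChartedSpace (EuclideanSpace ℝ (Fin n)) M] (f : M → ℝ) : Prop :=
  ∀ e ∈ atlas (EuclideanSpace ℝ (Fin n)) M,
    LocallyIntegrableOn (fun y => f (e.symm y)) e.target volume

/-- `φ ∈ W^p_2(M)` for compact `M`: in every chart, `φ` has weak derivatives of order `≤ 2` which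
are in `L^p` on compact subsets of the chart domain. -/
def ManifoldMemW2 (n : ℕ) {M : Type*} [TopologicalSpace M]
    [ChartedSpace (EuclideanSpace ℝ (Fin n)) M] (p : ℝ) (φ : M → ℝ) : Prop :=
  ∀ e ∈ atlas (EuclideanSpace ℝ (Fin n)) M, MemW2Loc e.target p (fun y => φ (e.symm y))

/-- For a function `f ≥ 0` defined almost everywhere, `f ≢ 0` means that there is a nonempty open
set on which the (essential) infimum of `f` is positive. -/
def ManifoldNotIdenticallyZero (n : ℕ) {M : Type*} [TopologicalSpace M]
    [ChartedSpace (EuclideanSpace ℝ (Fin n)) M] (f : M → ℝ) : Prop :=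
  ∃ U : Set M, IsOpen U ∧ U.Nonempty ∧
    ∃ c : ℝ, 0 < c ∧ ManifoldAE n (fun x : M => x ∈ U → c ≤ f x)

variable [IsManifold (𝓡 n) ∞ M]

/-- The components `γ_{ij} = γ(∂_i, ∂_j)` of `γ` in the chart `e`, as functions of the
coordinates `y`. -/
def metricComponents
    (γ : ContinuousRiemannianMetric (EuclideanSpace ℝ (Fin n))
      (fun x : M => TangentSpace (𝓡 n) x))
    (e : OpenPartialHomeomorph M (EuclideanSpace ℝ (Fin n))) (y : EuclideanSpace ℝ (Fin n)) :
    Matrix (Fin n) (Fin n) ℝ :=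
  Matrix.of fun i j =>
    γ.inner (e.symm y)
      (mfderiv (𝓡 n) (𝓡 n) e.symm y (EuclideanSpace.single i (1 : ℝ) : EuclideanSpace ℝ (Fin n)))
      (mfderiv (𝓡 n) (𝓡 n) e.symm y (EuclideanSpace.single j (1 : ℝ) : EuclideanSpace ℝ (Fin n)))

/-- `γ ∈ M^p_2`: the components of the Riemannian metric `γ` in every chart have weak derivatives
of order `≤ 2` in `L^p_loc`. For `p > n / 2` an element of `W^p_2` is identified with its continuous
representative; accordingly `γ` is a continuous, everywhere positive definite metric. -/
def MetricMemW2 (p : ℝ)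
    (γ : ContinuousRiemannianMetric (EuclideanSpace ℝ (Fin n))
      (fun x : M => TangentSpace (𝓡 n) x)) : Prop :=
  ∀ e ∈ atlas (EuclideanSpace ℝ (Fin n)) M, ∀ i j,
    MemW2Loc e.target p (fun y => metricComponents γ e y i j)

/-- The function `R`, defined up to null sets, is the scalar curvature of `γ`. -/
def IsScalarCurvature
    (γ : ContinuousRiemannianMetric (EuclideanSpace ℝ (Fin n))
      (fun x : M => TangentSpace (𝓡 n) x)) (R : M → ℝ) : Prop :=
  ∀ e ∈ atlas (EuclideanSpace ℝ (Fin n)) M, ∀ᵐ y ∂(volume.restrict e.target),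
    R (e.symm y) = coordScalarCurvature e.target (metricComponents γ e) y

/-- The function `F`, defined up to null sets, is `Δ_γ φ`. -/
def IsLaplacian
    (γ : ContinuousRiemannianMetric (EuclideanSpace ℝ (Fin n))
      (fun x : M => TangentSpace (𝓡 n) x)) (φ F : M → ℝ) : Prop :=
  ∀ e ∈ atlas (EuclideanSpace ℝ (Fin n)) M, ∀ᵐ y ∂(volume.restrict e.target),
    F (e.symm y) = coordLaplacian e.target (metricComponents γ e) (fun z => φ (e.symm z)) y

/-- `φ` satisfies (almost everywhere) the Lichnerowicz equation
`Δ_γ φ = r φ - a φ^{-(3n-2)/(n-2)} - q₁ φ^{-n/(n-2)} + (b - q₂) φ^{(n+2)/(n-2)}`. -/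
def SatisfiesLichnerowicz
    (γ : ContinuousRiemannianMetric (EuclideanSpace ℝ (Fin n))
      (fun x : M => TangentSpace (𝓡 n) x)) (r a q₁ q₂ b φ : M → ℝ) : Prop :=
  IsLaplacian γ φ (fun x =>
    r x * φ x - a x * φ x ^ (-((3 * (n : ℝ) - 2) / ((n : ℝ) - 2)))
      - q₁ x * φ x ^ (-((n : ℝ) / ((n : ℝ) - 2)))
      + (b x - q₂ x) * φ x ^ (((n : ℝ) + 2) / ((n : ℝ) - 2)))

end Manifold

end

/-! At a positive solution all terms on the right of the equation have the same weak sign: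
nonpositive in the first case and, since the terms in `a` and `q₁` drop out, nonnegative in the
second. The integral of `Δ_γ φ` over a closed manifold is zero, so the right-hand side vanishes
almost everywhere. Then each term vanishes, and as powers of `φ` are positive, so does each
coefficient. This contradicts the positive lower bound on an open set. Neither a maximum principle
nor continuity of `φ` is needed.

The work lies in the integral identity at this regularity. In a chart the Laplacian is given in
nondivergence form, with Christoffel symbols made of weak derivatives.
`setIntegral_sqrt_det_mul_coordLaplacian` turns it into `∫ √g Δu ψ = -∫ √g gⁱʲ ∂ᵢψ ∂ⱼu`. Only the
metric is mollified: a smooth metric satisfies `∂ᵢ(√g gⁱᵏ) = -√g gⁱʲ Γᵏᵢⱼ`, and the second weak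
derivatives of `u` enter linearly. In the limit the metrics converge locally uniformly and their
first derivatives in `L²`. Products `∂g ∂u` are under control because `p > n/2` and `n ≥ 3` put
first derivatives in `L²_loc` (`memLp_two_restrict_of_isWeakPartial`).

Globally no volume measure is constructed. With a partition of unity `fᵢ` subordinate to charts, the
weak form tested with `fᵢ` gives `-∫ ⟨∇fᵢ, ∇φ⟩`. This is split as a sum over `j` of integrals of `fⱼ
⟨∇fᵢ, ∇φ⟩`, each moved to the chart `j` by `setIntegral_mul_gradPairing_transition`, which rests on
the chain rule for weak derivatives. There, summing over `i` produces the gradient of the constant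
`1`. The outcome is `exists_open_laplacian_eq_zero`. -/

noncomputable section

/-! ### Mollification in `L^p` -/

section Mollification

open Filter Metric
open scoped Topology Convolution

variable {E : Type*} [NormedAddCommGroup E] [NormedSpace ℝ E] [FiniteDimensional ℝ E]
  [MeasurableSpace E] [BorelSpace E] {μ : Measure E} [μ.IsAddHaarMeasure]

/-- Young's inequality for the mollification by a normalized bump function. -/
theorem eLpNorm_normed_convolution_le (φ : ContDiffBump (0 : E)) {f : E → ℝ}
    (hf : AEStronglyMeasurable f μ) {p : ℝ≥0∞} (hp1 : 1 ≤ p) (hp : p ≠ ⊤) :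
    eLpNorm (φ.normed μ ⋆[ContinuousLinearMap.lsmul ℝ ℝ, μ] f) p μ ≤ eLpNorm f p μ := by
  have hp0 : p ≠ 0 := (zero_lt_one.trans_le hp1).ne'
  set q := p.toReal with hq
  have hq1 : 1 ≤ q := by
    rw [hq, ← ENNReal.toReal_one]
    exact ENNReal.toReal_mono hp hp1
  have hq0 : 0 < q := zero_lt_one.trans_le hq1
  -- Both sides depend only on the almost everywhere class of `f`; genuine measurability is wanted
  -- for Tonelli.
  wlog hfm : StronglyMeasurable f generalizing f
  · have h := this hf.stronglyMeasurable_mk.aestronglyMeasurable hf.stronglyMeasurable_mk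
    rw [eLpNorm_congr_ae hf.ae_eq_mk]
    rwa [convolution_congr _ (EventuallyEq.refl _ _) hf.ae_eq_mk]
  have hηc : Continuous (φ.normed μ) := φ.contDiff_normed (n := 0) |>.continuous
  have hηm : Measurable (fun t => ENNReal.ofReal (φ.normed μ t)) := by fun_prop
  -- The bump is the density of a probability measure `ν`, so comparing `L¹(ν)` with `L^q(ν)` is
  -- Jensen's inequality. Tonelli and translation invariance then finish the estimate.
  set ν := μ.withDensity (fun t => ENNReal.ofReal (φ.normed μ t)) with hν
  have hνp : IsProbabilityMeasure ν := by
    refine ⟨?_⟩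
    rw [hν, withDensity_apply _ MeasurableSet.univ, Measure.restrict_univ,
      ← ofReal_integral_eq_lintegral_ofReal φ.integrable_normed
        (Eventually.of_forall φ.nonneg_normed), φ.integral_normed, ENNReal.ofReal_one]
  have hpt : ∀ x, ‖(φ.normed μ ⋆[ContinuousLinearMap.lsmul ℝ ℝ, μ] f) x‖ₑ ^ q ≤
      ∫⁻ t, ENNReal.ofReal (φ.normed μ t) * ‖f (x - t)‖ₑ ^ q ∂μ := by
    intro x
    have hsm : StronglyMeasurable fun t => f (x - t) :=
      hfm.comp_measurable (by fun_prop)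
    have h1 : ‖(φ.normed μ ⋆[ContinuousLinearMap.lsmul ℝ ℝ, μ] f) x‖ₑ ≤
        ∫⁻ t, ‖f (x - t)‖ₑ ∂ν := by
      rw [convolution_def]
      refine (enorm_integral_le_lintegral_enorm _).trans ?_
      rw [hν, lintegral_withDensity_eq_lintegral_mul _ hηm hsm.enorm]
      refine lintegral_mono fun t => ?_
      simp only [ContinuousLinearMap.lsmul_apply, smul_eq_mul, enorm_mul, Pi.mul_apply]
      rw [Real.enorm_of_nonneg (φ.nonneg_normed t)]
    have h2 := eLpNorm'_le_eLpNorm'_of_exponent_le (p := 1) (q := q) one_pos hq1 ν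
      (hsm.aestronglyMeasurable (μ := ν))
    simp only [eLpNorm'] at h2
    simp only [ENNReal.rpow_one, one_div, inv_one] at h2
    calc _ ≤ (∫⁻ t, ‖f (x - t)‖ₑ ∂ν) ^ q := by gcongr
      _ ≤ ((∫⁻ t, ‖f (x - t)‖ₑ ^ q ∂ν) ^ q⁻¹) ^ q := by gcongr
      _ = ∫⁻ t, ‖f (x - t)‖ₑ ^ q ∂ν := by
        rw [← ENNReal.rpow_mul, inv_mul_cancel₀ hq0.ne', ENNReal.rpow_one]
      _ = _ := by
        rw [hν, lintegral_withDensity_eq_lintegral_mul _ hηm (hsm.enorm.pow_const _)]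
        rfl
  rw [eLpNorm_eq_lintegral_rpow_enorm_toReal hp0 hp, eLpNorm_eq_lintegral_rpow_enorm_toReal hp0 hp]
  refine ENNReal.rpow_le_rpow ?_ (by positivity)
  calc _ ≤ ∫⁻ x, ∫⁻ t, ENNReal.ofReal (φ.normed μ t) * ‖f (x - t)‖ₑ ^ q ∂μ ∂μ :=
        lintegral_mono hpt
    _ = ∫⁻ t, ∫⁻ x, ENNReal.ofReal (φ.normed μ t) * ‖f (x - t)‖ₑ ^ q ∂μ ∂μ := by
        apply lintegral_lintegral_swap
        apply Measurable.aemeasurable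
        have := hfm.measurable
        change Measurable fun z : E × E =>
          ENNReal.ofReal (φ.normed μ z.2) * ‖f (z.1 - z.2)‖ₑ ^ q
        fun_prop
    _ = ∫⁻ t, ENNReal.ofReal (φ.normed μ t) * ∫⁻ x, ‖f x‖ₑ ^ q ∂μ ∂μ := by
        refine lintegral_congr fun t => ?_
        rw [lintegral_const_mul' _ _ ENNReal.ofReal_ne_top,
          lintegral_sub_right_eq_self (fun x => ‖f x‖ₑ ^ q) t]
    _ = ∫⁻ x, ‖f x‖ₑ ^ q ∂μ := by
        rw [lintegral_mul_const _ hηm, ← ofReal_integral_eq_lintegral_ofReal φ.integrable_normed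
        (Eventually.of_forall φ.nonneg_normed), φ.integral_normed, ENNReal.ofReal_one, one_mul]

/-- Uniform continuity of `g` bounds the difference by `δ` once the radius is small. For radius
below `1` the difference vanishes off the 1-thickening `K` of the support, so its norm is at most
`δ` times that of the indicator of `K`. -/
theorem HasCompactSupport.tendsto_eLpNorm_normed_convolution_sub {φ : ℕ → ContDiffBump (0 : E)}
    (hφ : Tendsto (fun m => (φ m).rOut) atTop (𝓝 0)) {g : E → ℝ} (hgc : HasCompactSupport g)
    (hg : Continuous g) {p : ℝ≥0∞} :
    Tendsto (fun m => eLpNorm ((φ m).normed μ ⋆[ContinuousLinearMap.lsmul ℝ ℝ, μ] g - g) p μ)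
      atTop (𝓝 0) := by
  set K := cthickening 1 (tsupport g)
  have hK : IsCompact K := IsCompact.cthickening hgc
  rw [ENNReal.tendsto_nhds_zero]
  intro ε hε
  have hC : eLpNorm (K.indicator fun _ => (1 : ℝ)) p μ ≠ ⊤ :=
    (memLp_indicator_const p hK.measurableSet 1 (Or.inr hK.measure_lt_top.ne)).eLpNorm_ne_top
  set C := eLpNorm (K.indicator fun _ => (1 : ℝ)) p μ
  obtain ⟨δ, hδ0, hδ⟩ : ∃ δ : NNReal, 0 < δ ∧ (δ : ℝ≥0∞) * C ≤ ε := by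
    obtain ⟨δ, h0, h⟩ := ENNReal.exists_nnreal_pos_mul_lt hC hε.ne'
    exact ⟨δ, h0, h.le⟩
  have huc : UniformContinuous g := hg.uniformContinuous_of_tendsto_cocompact
    hgc.is_zero_at_infty
  obtain ⟨η, hη0, hη⟩ := Metric.uniformContinuous_iff.1 huc δ hδ0
  filter_upwards [hφ.eventually_lt_const hη0, hφ.eventually_lt_const one_pos] with m hm hm1
  have hb : ∀ x, ‖((φ m).normed μ ⋆[ContinuousLinearMap.lsmul ℝ ℝ, μ] g - g) x‖ ≤
      ‖((δ : ℝ) • K.indicator fun _ => (1 : ℝ)) x‖ := by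
    intro x
    by_cases hx : x ∈ K
    · simp only [Pi.sub_apply, Pi.smul_apply, hx, indicator_of_mem, smul_eq_mul, mul_one]
      rw [← dist_eq_norm, Real.norm_of_nonneg δ.coe_nonneg]
      refine (φ m).dist_normed_convolution_le hg.aestronglyMeasurable fun y hy => ?_
      exact (hη (lt_trans (mem_ball.1 hy) hm)).le
    · have hz : ∀ y ∈ ball x (φ m).rOut, g y = 0 := by
        intro y hy
        by_contra h0
        apply hx
        refine mem_cthickening_of_dist_le x y 1 _ (subset_tsupport _ h0) ?_
        rw [dist_comm]
        exact (mem_ball.1 hy).le.trans hm1.le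
      have hgx : g x = 0 := hz x (mem_ball_self (φ m).rOut_pos)
      have := (φ m).normed_convolution_eq_right (μ := μ) (g := g) (x₀ := x)
        fun y hy => (hz y hy).trans hgx.symm
      simp only [Pi.sub_apply, this, sub_self, norm_zero]
      exact norm_nonneg _
  refine (eLpNorm_mono hb).trans ?_
  rw [eLpNorm_const_smul]
  refine le_trans (le_of_eq ?_) hδ
  simp [C]

/-- Mollifications of an `L^p` function converge to it in `L^p`. -/
theorem MeasureTheory.MemLp.tendsto_eLpNorm_normed_convolution_sub {φ : ℕ → ContDiffBump (0 : E)}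
    (hφ : Tendsto (fun m => (φ m).rOut) atTop (𝓝 0)) {f : E → ℝ} {p : ℝ≥0∞}
    (hf : MemLp f p μ) (hp1 : 1 ≤ p) (hp : p ≠ ⊤) :
    Tendsto (fun m => eLpNorm ((φ m).normed μ ⋆[ContinuousLinearMap.lsmul ℝ ℝ, μ] f - f) p μ)
      atTop (𝓝 0) := by
  rw [ENNReal.tendsto_nhds_zero]
  intro ε hε
  have hε3 : ε / 3 ≠ 0 := (ENNReal.div_pos hε.ne' (by norm_num)).ne'
  -- Density of continuous compactly supported functions: Young's inequality handles the
  -- mollification of `f - g`, uniformly in `m`, and the previous lemma handles `g`.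
  obtain ⟨g, hgc, hfg, hg, hgp⟩ := hf.exists_hasCompactSupport_eLpNorm_sub_le hp hε3
  have := hgc.tendsto_eLpNorm_normed_convolution_sub (μ := μ) (p := p) hφ hg
  rw [ENNReal.tendsto_nhds_zero] at this
  filter_upwards [this (ε / 3) (pos_iff_ne_zero.2 hε3)] with m hm
  have hex : ∀ {h : E → ℝ}, LocallyIntegrable h μ →
      ConvolutionExists ((φ m).normed μ) h (ContinuousLinearMap.lsmul ℝ ℝ) μ := fun hh =>
    (φ m).hasCompactSupport_normed.convolutionExists_left _
      ((φ m).contDiff_normed (n := 0)).continuous hh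
  have hcm : ∀ {h : E → ℝ}, LocallyIntegrable h μ →
      AEStronglyMeasurable ((φ m).normed μ ⋆[ContinuousLinearMap.lsmul ℝ ℝ, μ] h) μ := fun hh =>
    ((φ m).hasCompactSupport_normed.continuous_convolution_left _
      ((φ m).contDiff_normed (n := 0)).continuous hh).aestronglyMeasurable
  have hfl : LocallyIntegrable f μ := hf.locallyIntegrable hp1
  have hgl : LocallyIntegrable g μ := hgp.locallyIntegrable hp1
  have hsplit : (φ m).normed μ ⋆[ContinuousLinearMap.lsmul ℝ ℝ, μ] f - f =
      ((φ m).normed μ ⋆[ContinuousLinearMap.lsmul ℝ ℝ, μ] (f - g)) +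
      (((φ m).normed μ ⋆[ContinuousLinearMap.lsmul ℝ ℝ, μ] g - g) - (f - g)) := by
    have : f = (f - g) + g := by simp
    conv_lhs => lhs; rw [this]
    rw [(hex (hfl.sub hgl)).distrib_add (hex hgl)]
    abel
  rw [hsplit]
  calc _ ≤ eLpNorm ((φ m).normed μ ⋆[ContinuousLinearMap.lsmul ℝ ℝ, μ] (f - g)) p μ +
        (eLpNorm ((φ m).normed μ ⋆[ContinuousLinearMap.lsmul ℝ ℝ, μ] g - g) p μ +
          eLpNorm (f - g) p μ) := by
        refine (eLpNorm_add_le (hcm (hfl.sub hgl)) (((hcm hgl).sub hgp.1).sub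
          (hf.1.sub hgp.1)) hp1).trans ?_
        gcongr
        exact eLpNorm_sub_le ((hcm hgl).sub hgp.1) (hf.1.sub hgp.1) hp1
    _ ≤ ε / 3 + (ε / 3 + ε / 3) := by
        gcongr
        exact (eLpNorm_normed_convolution_le _ (hf.1.sub hgp.1) hp1 hp).trans hfg
    _ = ε := by rw [← add_assoc, ENNReal.add_thirds]

end Mollification

/-! ### Weak partial derivatives: uniqueness, localisation, mollification -/

section WeakPartialBasics

open Filter Metric
open scoped Topology Convolution

variable {n : ℕ} {Ω Ω' : Set (EuclideanSpace ℝ (Fin n))} {i : Fin n}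
  {u v v' : EuclideanSpace ℝ (Fin n) → ℝ}

theorem isWeakPartial_weakPartial (h : ∃ v, IsWeakPartial Ω i u v) :
    IsWeakPartial Ω i u (weakPartial Ω i u) := by
  rw [weakPartial, dif_pos h]
  exact h.choose_spec

theorem fderiv_apply_eq_zero_of_notMem_tsupport {ψ : EuclideanSpace ℝ (Fin n) → ℝ}
    {y : EuclideanSpace ℝ (Fin n)} (hy : y ∉ tsupport ψ) : fderiv ℝ ψ y = 0 := by
  have : ψ =ᶠ[𝓝 y] fun _ => 0 := notMem_tsupport_iff_eventuallyEq.1 hy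
  rw [this.fderiv_eq]
  simp

/-- Integrals against test functions do not see the domain of integration; this and its companion
for derivatives let weak derivatives be restricted and domains be exchanged. -/
theorem setIntegral_mul_eq_integral_of_tsupport_subset {ψ : EuclideanSpace ℝ (Fin n) → ℝ}
    (hψ : tsupport ψ ⊆ Ω) (v : EuclideanSpace ℝ (Fin n) → ℝ) :
    ∫ y in Ω, v y * ψ y = ∫ y, v y * ψ y := by
  refine setIntegral_eq_integral_of_forall_compl_eq_zero fun y hy => ?_
  rw [image_eq_zero_of_notMem_tsupport fun h => hy (hψ h), mul_zero]

theorem setIntegral_mul_fderiv_eq_integral_of_tsupport_subset {ψ : EuclideanSpace ℝ (Fin n) → ℝ}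
    (hψ : tsupport ψ ⊆ Ω) (v : EuclideanSpace ℝ (Fin n) → ℝ) (e : EuclideanSpace ℝ (Fin n)) :
    ∫ y in Ω, v y * fderiv ℝ ψ y e = ∫ y, v y * fderiv ℝ ψ y e := by
  refine setIntegral_eq_integral_of_forall_compl_eq_zero fun y hy => ?_
  rw [fderiv_apply_eq_zero_of_notMem_tsupport fun h => hy (hψ h)]
  simp

theorem IsWeakPartial.mono (h : IsWeakPartial Ω i u v) (hs : Ω' ⊆ Ω) :
    IsWeakPartial Ω' i u v := by
  refine ⟨h.1.mono_set hs, h.2.1.mono_set hs, fun ψ h1 h2 h3 => ?_⟩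
  have := h.2.2 ψ h1 h2 (h3.trans hs)
  rw [setIntegral_mul_eq_integral_of_tsupport_subset h3,
    setIntegral_mul_fderiv_eq_integral_of_tsupport_subset h3]
  rwa [setIntegral_mul_eq_integral_of_tsupport_subset (h3.trans hs),
    setIntegral_mul_fderiv_eq_integral_of_tsupport_subset (h3.trans hs)] at this

theorem MeasureTheory.LocallyIntegrableOn.integrable_mul_of_tsupport_subset
    {ψ : EuclideanSpace ℝ (Fin n) → ℝ} (hv : LocallyIntegrableOn v Ω volume)
    (hc : Continuous ψ) (hψ : HasCompactSupport ψ) (hs : tsupport ψ ⊆ Ω) :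
    Integrable (fun y => v y * ψ y) := by
  have hK := hv.integrableOn_compact_subset hs hψ
  have h1 := (hK.mul_continuousOn hc.continuousOn hψ)
  rwa [integrableOn_iff_integrable_of_support_subset] at h1
  intro y hy
  by_contra h
  exact hy (by simp [image_eq_zero_of_notMem_tsupport h])

/-- Weak partial derivatives are unique up to null sets. -/
theorem IsWeakPartial.ae_eq (hΩ : IsOpen Ω) (h : IsWeakPartial Ω i u v)
    (h' : IsWeakPartial Ω i u v') : ∀ᵐ y ∂(volume.restrict Ω), v y = v' y := by
  have key : ∀ᵐ y ∂volume, y ∈ Ω → (v - v') y = 0 := by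
    refine hΩ.ae_eq_zero_of_integral_contDiff_smul_eq_zero (h.2.1.sub h'.2.1)
      fun ψ h1 h2 h3 => ?_
    have e1 := h.2.2 ψ h1 h2 h3
    have e2 := h'.2.2 ψ h1 h2 h3
    rw [e1, neg_inj, setIntegral_mul_eq_integral_of_tsupport_subset h3,
      setIntegral_mul_eq_integral_of_tsupport_subset h3] at e2
    have i1 := h.2.1.integrable_mul_of_tsupport_subset h1.continuous h2 h3
    have i2 := h'.2.1.integrable_mul_of_tsupport_subset h1.continuous h2 h3
    rw [← sub_eq_zero, ← integral_sub i1 i2] at e2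
    rw [← e2]
    refine integral_congr_ae (Eventually.of_forall fun y => ?_)
    simp only [Pi.sub_apply, smul_eq_mul]
    ring
  rw [ae_restrict_iff' hΩ.measurableSet]
  filter_upwards [key] with y hy hyΩ
  exact sub_eq_zero.1 (hy hyΩ)

/-- Classical integration by parts of a smooth function against a test function. -/
theorem integral_mul_fderiv_eq_neg_of_tsupport_subset {w ψ : EuclideanSpace ℝ (Fin n) → ℝ}
    (hw : ∀ x ∈ tsupport ψ, ContDiffAt ℝ ∞ w x) (hψ : ContDiff ℝ ∞ ψ) (hc : HasCompactSupport ψ)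
    (e : EuclideanSpace ℝ (Fin n)) :
    ∫ y, w y * fderiv ℝ ψ y e = - ∫ y, fderiv ℝ w y e * ψ y := by
  have hs : ∀ f : EuclideanSpace ℝ (Fin n) → ℝ, (∀ x ∈ tsupport ψ, ContinuousAt f x) →
      (Function.support f ⊆ tsupport ψ) → Integrable f := by
    intro f hf hfs
    rw [← integrableOn_iff_integrable_of_support_subset hfs]
    exact ContinuousOn.integrableOn_compact hc fun x hx => (hf x hx).continuousWithinAt
  refine integral_mul_fderiv_eq_neg_fderiv_mul_of_integrable
    (hs _ (fun x hx => ContinuousAt.mul ?_ hψ.continuous.continuousAt) fun y hy => ?_)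
    (hs _ (fun x hx => (hw x hx).continuousAt.mul
      ((hψ.continuous_fderiv (by simp)).clm_apply continuous_const).continuousAt) fun y hy => ?_)
    (hs _ (fun x hx => (hw x hx).continuousAt.mul hψ.continuous.continuousAt) fun y hy => ?_)
    (fun x hx => (hw x hx).differentiableAt (by simp))
    (fun x _ => hψ.differentiable (by simp) x)
  · exact (((hw x hx).fderiv_right (m := 0) (by simp)).continuousAt).clm_apply continuousAt_const
  · by_contra h
    exact hy (by simp [image_eq_zero_of_notMem_tsupport h])
  · by_contra h
    exact hy (by simp [fderiv_apply_eq_zero_of_notMem_tsupport h])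
  · by_contra h
    exact hy (by simp [image_eq_zero_of_notMem_tsupport h])

/-- Off its support a function is locally zero. This yields test functions as products or pullbacks
whose factors are smooth only on an open set. -/
theorem contDiff_of_contDiffAt_tsupport {f : EuclideanSpace ℝ (Fin n) → ℝ}
    (hf : ∀ x ∈ tsupport f, ContDiffAt ℝ ∞ f x) : ContDiff ℝ ∞ f := by
  rw [← contMDiff_iff_contDiff]
  exact contMDiff_of_tsupport fun x hx => (hf x hx).contMDiffAt

/-- Mollification commutes with weak differentiation, away from the boundary. -/
theorem IsWeakPartial.fderiv_normed_convolution (h : IsWeakPartial Ω i u v)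
    (φ : ContDiffBump (0 : EuclideanSpace ℝ (Fin n))) {K : Set (EuclideanSpace ℝ (Fin n))}
    (hK : IsCompact K) (hKΩ : K ⊆ Ω) {x : EuclideanSpace ℝ (Fin n)}
    (hx : closedBall x φ.rOut ⊆ K) :
    fderiv ℝ (φ.normed volume ⋆[ContinuousLinearMap.lsmul ℝ ℝ, volume] K.indicator u) x
      (EuclideanSpace.single i 1) =
    (φ.normed volume ⋆[ContinuousLinearMap.lsmul ℝ ℝ, volume] K.indicator v) x := by
  have hui : Integrable (K.indicator u) :=
    (h.1.integrableOn_compact_subset hKΩ hK).integrable_indicator hK.measurableSet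
  have hη : ContDiff ℝ ∞ (φ.normed volume) := φ.contDiff_normed
  set η : EuclideanSpace ℝ (Fin n) → ℝ := φ.normed volume with hηdef
  have hηc : HasCompactSupport η := φ.hasCompactSupport_normed
  have hd := hηc.hasFDerivAt_convolution_left (ContinuousLinearMap.lsmul ℝ ℝ)
    (hη.of_le (by simp)) hui.locallyIntegrable x (μ := volume)
  -- The reflected and translated bump is an admissible test function, being supported in the ball
  -- about `x`, inside `K`; there the cutoff to `K` is invisible. The sign from the reflection
  -- cancels the one in the definition of the weak derivative.
  set ψ : EuclideanSpace ℝ (Fin n) → ℝ := fun t => η (x - t) with hψdef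
  have hψ : ContDiff ℝ ∞ ψ := hη.comp (contDiff_const.sub contDiff_id)
  have hsupp : Function.support ψ ⊆ closedBall x φ.rOut := by
    intro t ht
    have : x - t ∈ Function.support η := ht
    rw [hηdef, φ.support_normed_eq, mem_ball_zero_iff, ← dist_eq_norm] at this
    rw [mem_closedBall, dist_comm]
    exact this.le
  have hts : tsupport ψ ⊆ closedBall x φ.rOut := closure_minimal hsupp isClosed_closedBall
  have hψc : HasCompactSupport ψ := (isCompact_closedBall x φ.rOut).of_isClosed_subset
    (isClosed_tsupport _) hts
  have hdψ : ∀ t e, fderiv ℝ ψ t e = - fderiv ℝ η (x - t) e := by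
    intro t e
    have h1 : HasFDerivAt (fun t => x - t) (-(ContinuousLinearMap.id ℝ
        (EuclideanSpace ℝ (Fin n)))) t := by
      simpa using (hasFDerivAt_id t).const_sub x
    have h2 := ((hη.differentiable (by simp) (x - t)).hasFDerivAt).comp t h1
    have h3 : fderiv ℝ ψ t = _ := h2.fderiv
    rw [h3]
    simp
  have hw := h.2.2 ψ hψ hψc (hts.trans (hx.trans hKΩ))
  rw [setIntegral_mul_eq_integral_of_tsupport_subset (hts.trans (hx.trans hKΩ)),
    setIntegral_mul_fderiv_eq_integral_of_tsupport_subset (hts.trans (hx.trans hKΩ))] at hw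
  rw [hd.fderiv, convolution_eq_swap, convolution_eq_swap]
  rw [ContinuousLinearMap.integral_apply]
  · have e1 : ∀ t, (((ContinuousLinearMap.lsmul ℝ ℝ).precompL (EuclideanSpace ℝ (Fin n)))
        (fderiv ℝ η (x - t)) (K.indicator u t)) (EuclideanSpace.single i 1) =
        - (u t * fderiv ℝ ψ t (EuclideanSpace.single i 1)) := by
      intro t
      rw [ContinuousLinearMap.precompL_apply, ContinuousLinearMap.lsmul_apply, smul_eq_mul, hdψ]
      by_cases ht : t ∈ K
      · rw [indicator_of_mem ht]; ring
      · have : fderiv ℝ ψ t (EuclideanSpace.single i 1) = 0 := by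
          rw [fderiv_apply_eq_zero_of_notMem_tsupport fun h => ht (hx (hts h))]
          simp
        rw [indicator_of_notMem ht, ← hdψ, this]
        simp
    have e2 : ∀ t, ContinuousLinearMap.lsmul ℝ ℝ (η (x - t)) (K.indicator v t) = v t * ψ t := by
      intro t
      rw [ContinuousLinearMap.lsmul_apply, smul_eq_mul]
      by_cases ht : t ∈ K
      · rw [indicator_of_mem ht, mul_comm]
      · have h0 : ψ t = 0 := image_eq_zero_of_notMem_tsupport fun h => ht (hx (hts h))
        rw [indicator_of_notMem ht, h0]
        simp
    simp_rw [e1, e2, integral_neg, hw, neg_neg]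
  · have := (hηc.fderiv (𝕜 := ℝ)).convolutionExists_left
      ((ContinuousLinearMap.lsmul ℝ ℝ).precompL (EuclideanSpace ℝ (Fin n))) (μ := volume)
      (hη.continuous_fderiv (by simp)) hui.locallyIntegrable x
    exact this.integrable_swap

end WeakPartialBasics

/-! ### Sobolev embedding of first derivatives into `L²_loc` -/

section SobolevEmbedding

open Filter Metric
open scoped Topology Convolution

variable {n : ℕ} {Ω : Set (EuclideanSpace ℝ (Fin n))}

theorem norm_le_sum_abs_apply_single (L : EuclideanSpace ℝ (Fin n) →L[ℝ] ℝ) :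
    ‖L‖ ≤ ∑ i, |L (EuclideanSpace.single i 1)| := by
  refine L.opNorm_le_bound (Finset.sum_nonneg fun i _ => abs_nonneg _) fun x => ?_
  have hx : x = ∑ i, x i • EuclideanSpace.single i (1 : ℝ) := by
    ext j
    simp [Finset.sum_apply, Pi.single_apply]
  conv_lhs => rw [hx]
  rw [map_sum, Finset.sum_mul]
  refine (norm_sum_le _ _).trans (Finset.sum_le_sum fun i _ => ?_)
  rw [map_smul, smul_eq_mul, norm_mul, mul_comm, Real.norm_eq_abs (L _)]
  gcongr
  exact PiLp.norm_apply_le x i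

/-- A smooth cutoff equal to `1` on a compact subset of an open set. -/
theorem exists_contDiff_eq_one_of_isCompact {K U : Set (EuclideanSpace ℝ (Fin n))}
    (hK : IsCompact K) (hU : IsOpen U) (hKU : K ⊆ U) :
    ∃ ζ : EuclideanSpace ℝ (Fin n) → ℝ, ContDiff ℝ ∞ ζ ∧ HasCompactSupport ζ ∧ tsupport ζ ⊆ U ∧
      (∀ x ∈ K, ζ x = 1) ∧ ∀ x, |ζ x| ≤ 1 := by
  obtain ⟨δ, hδ0, hδ⟩ := hK.exists_cthickening_subset_open hU hKU
  obtain ⟨f, hf0, hf1, hf⟩ := exists_contMDiffMap_zero_one_of_isClosed (n := (⊤ : ℕ∞))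
    𝓘(ℝ, EuclideanSpace ℝ (Fin n)) (s := (thickening δ K)ᶜ) (t := K)
    isOpen_thickening.isClosed_compl hK.isClosed
    (disjoint_compl_left_iff_subset.2 (self_subset_thickening hδ0 K))
  have hs : tsupport f ⊆ cthickening δ K := by
    refine closure_minimal (fun x hx => ?_) isClosed_cthickening
    by_contra h
    exact hx (hf0 fun h' => h (thickening_subset_cthickening δ K h'))
  refine ⟨f, f.contMDiff.contDiff, hK.cthickening.of_isClosed_subset (isClosed_tsupport _) hs,
    hs.trans hδ, fun x hx => hf1 hx, fun x => ?_⟩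
  rw [abs_of_nonneg (hf x).1]
  exact (hf x).2

/-- A sequence of bump functions with radii shrinking to zero. -/
def shrinkingBump (δ : ℝ) (hδ : 0 < δ) (m : ℕ) : ContDiffBump (0 : EuclideanSpace ℝ (Fin n)) where
  rIn := δ / (2 * (m + 1))
  rOut := δ / (m + 1)
  rIn_pos := by positivity
  rIn_lt_rOut := by
    apply div_lt_div_of_pos_left hδ (by positivity)
    have : (0 : ℝ) < m + 1 := by positivity
    linarith

theorem shrinkingBump_rOut_le {δ : ℝ} (hδ : 0 < δ) (m : ℕ) :
    (shrinkingBump δ hδ m : ContDiffBump (0 : EuclideanSpace ℝ (Fin n))).rOut ≤ δ :=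
  div_le_self hδ.le (by linarith [m.cast_nonneg (α := ℝ)])

theorem tendsto_shrinkingBump_rOut {δ : ℝ} (hδ : 0 < δ) :
    Tendsto (fun m => (shrinkingBump δ hδ m : ContDiffBump (0 : EuclideanSpace ℝ (Fin n))).rOut)
      atTop (𝓝 0) := by
  have := tendsto_one_div_add_atTop_nhds_zero_nat.const_mul δ
  simp only [mul_one_div, mul_zero] at this
  exact this

/-- The ratio of outer to inner radius is always `2`, the bounded ratio that Lebesgue
differentiation requires of the bumps. -/
theorem ae_tendsto_shrinkingBump_convolution {δ : ℝ} (hδ : 0 < δ)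
    {f : EuclideanSpace ℝ (Fin n) → ℝ} (hf : LocallyIntegrable f) :
    ∀ᵐ x, Tendsto (fun m => ((shrinkingBump δ hδ m).normed volume
      ⋆[ContinuousLinearMap.lsmul ℝ ℝ, volume] f) x) atTop (𝓝 (f x)) := by
  refine ContDiffBump.ae_convolution_tendsto_right_of_locallyIntegrable (K := 2)
    (tendsto_shrinkingBump_rOut hδ) (Eventually.of_forall fun m => le_of_eq ?_) hf
  simp only [shrinkingBump]
  field_simp

theorem MemLpLoc.memLp_indicator {p q : ℝ} {u : EuclideanSpace ℝ (Fin n) → ℝ}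
    (hu : MemLpLoc Ω p u) {K : Set (EuclideanSpace ℝ (Fin n))} (hK : IsCompact K) (hKΩ : K ⊆ Ω)
    (hqp : q ≤ p) : MemLp (K.indicator u) (ENNReal.ofReal q) := by
  rw [memLp_indicator_iff_restrict hK.measurableSet]
  have : IsFiniteMeasure (volume.restrict K) := ⟨by simpa using hK.measure_lt_top⟩
  exact (hu K hKΩ hK).mono_exponent (ENNReal.ofReal_le_ofReal hqp)

/-- The Sobolev embedding `W^{1,p}_loc ⊆ L²_loc` for `p > n / 2`, `n ≥ 3`. -/
theorem memLp_two_restrict_of_isWeakPartial (hn : 3 ≤ n) (hΩ : IsOpen Ω) {p : ℝ}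
    (hp : (n : ℝ) / 2 < p) {u : EuclideanSpace ℝ (Fin n) → ℝ}
    {v : Fin n → EuclideanSpace ℝ (Fin n) → ℝ} (hu : MemLpLoc Ω p u)
    (huv : ∀ i, IsWeakPartial Ω i u (v i)) (hv : ∀ i, MemLpLoc Ω p (v i))
    {K : Set (EuclideanSpace ℝ (Fin n))} (hKΩ : K ⊆ Ω) (hK : IsCompact K) :
    MemLp u 2 (volume.restrict K) := by
  have hn' : (3 : ℝ) ≤ n := by exact_mod_cast hn
  obtain ⟨δ, hδ0, hδ⟩ := hK.exists_cthickening_subset_open hΩ hKΩ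
  set K' := cthickening δ K
  have hK' : IsCompact K' := hK.cthickening
  have hδ2 : 0 < δ / 2 := half_pos hδ0
  -- The margin `δ` is shared: half for the support of the cutoff, half for the mollification
  -- radius, so that every ball used stays in `K'`.
  obtain ⟨ζ, hζ, hζc, hζs, hζ1, hζb⟩ := exists_contDiff_eq_one_of_isCompact hK
    (isOpen_thickening (δ := δ / 2)) (self_subset_thickening hδ2 K)
  set φ : ℕ → ContDiffBump (0 : EuclideanSpace ℝ (Fin n)) := shrinkingBump (δ / 2) hδ2
  have hball : ∀ m, ∀ x ∈ tsupport ζ, closedBall x (φ m).rOut ⊆ K' := by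
    intro m x hx y hy
    obtain ⟨z, hz, hxz⟩ := mem_thickening_iff.1 (hζs hx)
    refine mem_cthickening_of_dist_le y z δ K hz ?_
    calc dist y z ≤ dist y x + dist x z := dist_triangle _ _ _
      _ ≤ δ / 2 + δ / 2 := add_le_add
        ((mem_closedBall.1 hy).trans (shrinkingBump_rOut_le hδ2 m)) hxz.le
      _ = δ := by ring
  -- The exponent with `1/s = 1/2 + 1/n`, whose Sobolev conjugate is `2`; `1 ≤ s ≤ n/2 < p` because
  -- `n ≥ 3`.
  set s : ℝ := 2 * n / (n + 2) with hs
  have hsp : s ≤ p := by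
    refine le_trans ?_ hp.le
    rw [hs, div_le_div_iff₀ (by linarith) two_pos]
    nlinarith
  have hs1 : 1 ≤ s := by
    rw [hs, le_div_iff₀ (by linarith)]
    linarith
  have hui := hu.memLp_indicator hK' hδ hsp
  have hvi := fun i => (hv i).memLp_indicator hK' hδ hsp
  have hs1' : 1 ≤ ENNReal.ofReal s := by
    rw [← ENNReal.ofReal_one]
    exact ENNReal.ofReal_le_ofReal hs1
  have huL : LocallyIntegrable (K'.indicator u) := hui.locallyIntegrable hs1'
  have hvL : ∀ i, LocallyIntegrable (K'.indicator (v i)) := fun i =>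
    (hvi i).locallyIntegrable hs1'
  set U : ℕ → EuclideanSpace ℝ (Fin n) → ℝ := fun m => (φ m).normed volume
    ⋆[ContinuousLinearMap.lsmul ℝ ℝ, volume] (K'.indicator u)
  set V : ℕ → Fin n → EuclideanSpace ℝ (Fin n) → ℝ := fun m i => (φ m).normed volume
    ⋆[ContinuousLinearMap.lsmul ℝ ℝ, volume] (K'.indicator (v i))
  have hcont : ∀ m {f : EuclideanSpace ℝ (Fin n) → ℝ}, LocallyIntegrable f →
      ContDiff ℝ ∞ ((φ m).normed volume ⋆[ContinuousLinearMap.lsmul ℝ ℝ, volume] f) :=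
    fun m f hf => (φ m).hasCompactSupport_normed.contDiff_convolution_left _
      (φ m).contDiff_normed hf
  obtain ⟨C₀, hC₀⟩ := (hζc.fderiv (𝕜 := ℝ)).exists_bound_of_continuous
    (hζ.continuous_fderiv (by simp))
  set C : ℝ := max C₀ 1 with hC
  have hC0 : 0 ≤ C := zero_le_one.trans (le_max_right _ _)
  -- Product rule: on the support of `ζ` the partial derivatives of `U m` are the mollified weak
  -- derivatives `V m i`. The constant `C` dominates both the gradient of `ζ` and the bound `1` for
  -- `ζ`.
  have hbound : ∀ m x, ‖fderiv ℝ (fun y => ζ y * U m y) x‖ ≤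
      ‖(fun x => C * (|U m x| + ∑ i, |V m i x|)) x‖ := by
    intro m x
    have hpos : 0 ≤ C * (|U m x| + ∑ i, |V m i x|) :=
      mul_nonneg hC0 (add_nonneg (abs_nonneg _) (Finset.sum_nonneg fun i _ => abs_nonneg _))
    rw [Real.norm_of_nonneg hpos]
    by_cases hx : x ∈ tsupport ζ
    · rw [fderiv_fun_mul (hζ.differentiable (by simp) x)
        ((hcont m huL).differentiable (by simp) x)]
      have h1 : ‖fderiv ℝ (U m) x‖ ≤ ∑ i, |V m i x| := by
        refine (norm_le_sum_abs_apply_single _).trans (le_of_eq ?_)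
        refine Finset.sum_congr rfl fun i _ => ?_
        rw [(huv i).fderiv_normed_convolution (φ m) hK' hδ (hball m x hx)]
      calc _ ≤ ‖ζ x • fderiv ℝ (U m) x‖ + ‖U m x • fderiv ℝ ζ x‖ := norm_add_le _ _
        _ ≤ 1 * ‖fderiv ℝ (U m) x‖ + |U m x| * C₀ := by
          rw [norm_smul, norm_smul]
          gcongr
          · exact hζb x
          · exact le_rfl
          · exact hC₀ x
        _ ≤ C * ∑ i, |V m i x| + |U m x| * C := by
          gcongr
          · exact le_max_right _ _
          · exact le_max_left _ _
        _ = _ := by ring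
    · have : x ∉ tsupport (fun y => ζ y * U m y) := fun h =>
        hx (tsupport_mul_subset_left (f := ζ) (g := U m) h)
      rw [fderiv_apply_eq_zero_of_notMem_tsupport this, norm_zero]
      exact hpos
  set B : ℝ≥0∞ := ENNReal.ofReal C * (eLpNorm (K'.indicator u) (ENNReal.ofReal s) volume +
    ∑ i, eLpNorm (K'.indicator (v i)) (ENNReal.ofReal s) volume) with hB
  have hBtop : B ≠ ⊤ := ENNReal.mul_ne_top ENNReal.ofReal_ne_top
    (ENNReal.add_ne_top.2 ⟨hui.eLpNorm_ne_top,
      ENNReal.sum_ne_top.2 fun i _ => (hvi i).eLpNorm_ne_top⟩)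
  have hgrad : ∀ m, eLpNorm (fderiv ℝ (fun y => ζ y * U m y)) (ENNReal.ofReal s) volume ≤ B := by
    intro m
    refine (eLpNorm_mono (hbound m)).trans ?_
    have e1 : (fun x => C * (|U m x| + ∑ i, |V m i x|)) =
        C • ((fun x => ‖U m x‖) + ∑ i, fun x => ‖V m i x‖) := by
      ext x
      simp [Finset.sum_apply]
    rw [e1, eLpNorm_const_smul, hB, Real.enorm_of_nonneg hC0]
    have hVm : ∀ i, AEStronglyMeasurable (fun x => ‖V m i x‖)
        (volume : Measure (EuclideanSpace ℝ (Fin n))) := fun i =>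
      (hcont m (hvL i)).continuous.norm.aestronglyMeasurable
    gcongr
    refine (eLpNorm_add_le (hcont m huL).continuous.norm.aestronglyMeasurable
      (Finset.aestronglyMeasurable_sum _ fun i _ => hVm i) hs1').trans ?_
    refine add_le_add ?_ ((eLpNorm_sum_le (fun i _ => hVm i) hs1').trans ?_)
    · rw [eLpNorm_norm]
      exact eLpNorm_normed_convolution_le _ hui.1 hs1' ENNReal.ofReal_ne_top
    · refine Finset.sum_le_sum fun i _ => ?_
      rw [eLpNorm_norm]
      exact eLpNorm_normed_convolution_le _ (hvi i).1 hs1' ENNReal.ofReal_ne_top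
  set c := SNormLESNormFDerivOfEqConst ℝ (volume : Measure (EuclideanSpace ℝ (Fin n)))
    (s.toNNReal : ℝ)
  -- Gagliardo–Nirenberg–Sobolev for smooth compactly supported functions, with a bound independent
  -- of `m`.
  have hGNS : ∀ m, eLpNorm (fun y => ζ y * U m y) 2 volume ≤ c * B := by
    intro m
    have h := eLpNorm_le_eLpNorm_fderiv_of_eq (F := ℝ)
      (volume : Measure (EuclideanSpace ℝ (Fin n)))
      (u := fun y => ζ y * U m y) (p := s.toNNReal) (p' := 2)
      ((hζ.mul (hcont m huL)).of_le (by simp)) hζc.mul_right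
      (by rw [← NNReal.coe_le_coe, Real.coe_toNNReal s (by linarith)]; exact_mod_cast hs1)
      (by rw [finrank_euclideanSpace_fin]; omega)
      (by
        rw [NNReal.coe_inv, Real.coe_toNNReal s (by linarith), finrank_euclideanSpace_fin, hs]
        push_cast
        field_simp
        ring)
    refine h.trans ?_
    gcongr
    exact hgrad m
  have hlim : ∀ᵐ x, Tendsto (fun m => ζ x * U m x) atTop (𝓝 (ζ x * K'.indicator u x)) := by
    filter_upwards [ae_tendsto_shrinkingBump_convolution hδ2 huL] with x hx
    exact hx.const_mul _
  -- Fatou's lemma carries the uniform `L²` bound to the almost everywhere limit, which is `u` on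
  -- `K`.
  have hfat := Lp.eLpNorm_lim_le_liminf_eLpNorm (p := 2)
    (fun m => (hζ.mul (hcont m huL)).continuous.aestronglyMeasurable) _ hlim
  have hfin : eLpNorm (fun x => ζ x * K'.indicator u x) 2 volume < ⊤ := by
    refine (hfat.trans ?_).trans_lt (ENNReal.mul_lt_top (ENNReal.coe_lt_top (r := c)) hBtop.lt_top)
    exact liminf_le_of_frequently_le' (Frequently.of_forall hGNS)
  have hmem : MemLp (fun x => ζ x * K'.indicator u x) 2 volume :=
    ⟨hζ.continuous.aestronglyMeasurable.mul hui.1, hfin⟩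
  refine (memLp_congr_ae ?_).1 (hmem.restrict K)
  filter_upwards [ae_restrict_mem hK.measurableSet] with x hx
  rw [hζ1 x hx, indicator_of_mem (self_subset_cthickening K hx), one_mul]

end SobolevEmbedding

/-! ### Derivatives of determinant and inverse; contracted Christoffel symbols -/

section MatrixCalculus

open Filter Matrix
open scoped Topology

variable {n : ℕ} {E : Type*} [NormedAddCommGroup E] [NormedSpace ℝ E]
  {g : E → Matrix (Fin n) (Fin n) ℝ} {x : E}

/-- Jacobi's formula for the derivative of the determinant. -/
theorem hasFDerivAt_det {g' : Fin n → Fin n → E →L[ℝ] ℝ}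
    (hg : ∀ i j, HasFDerivAt (fun y => g y i j) (g' i j) x) :
    HasFDerivAt (fun y => (g y).det) (∑ i, ∑ j, (g x).adjugate i j • g' j i) x := by
  have h1 : HasFDerivAt (fun y => ∑ σ : Equiv.Perm (Fin n),
      ((Equiv.Perm.sign σ : ℤ) : ℝ) * ∏ i, g y (σ i) i)
      (∑ σ : Equiv.Perm (Fin n), ((Equiv.Perm.sign σ : ℤ) : ℝ) •
        ∑ i, (∏ j ∈ Finset.univ.erase i, g x (σ j) j) • g' (σ i) i) x := by
    refine HasFDerivAt.fun_sum fun σ _ => HasFDerivAt.const_mul ?_ _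
    exact HasFDerivAt.finsetProd fun i _ => hg (σ i) i
  have e1 : (fun y => (g y).det) = fun y => ∑ σ : Equiv.Perm (Fin n),
      ((Equiv.Perm.sign σ : ℤ) : ℝ) * ∏ i, g y (σ i) i := by
    ext y
    rw [Matrix.det_apply']
  rw [e1]
  convert h1 using 1
  ext e
  have e2 : ∀ i, ∑ j, (g x).adjugate i j * g' j i e =
      ∑ σ : Equiv.Perm (Fin n), ((Equiv.Perm.sign σ : ℤ) : ℝ) *
        ((∏ j ∈ Finset.univ.erase i, g x (σ j) j) * g' (σ i) i e) := by
    intro i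
    -- By Cramer's rule, pairing row `i` of the adjugate with a vector gives the determinant with
    -- column `i` replaced by that vector, which is the `i`-th term of the product rule in the
    -- Leibniz expansion.
    have h2 := congrFun (Matrix.cramer_eq_adjugate_mulVec (g x) (fun j => g' j i e)) i
    rw [Matrix.mulVec, dotProduct] at h2
    rw [← h2, Matrix.cramer_apply, Matrix.det_apply']
    refine Finset.sum_congr rfl fun σ _ => ?_
    congr 1
    rw [← Finset.mul_prod_erase _ _ (Finset.mem_univ i), mul_comm]
    congr 1
    · refine Finset.prod_congr rfl fun j hj => ?_
      rw [Matrix.updateCol_ne (Finset.ne_of_mem_erase hj)]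
    · rw [Matrix.updateCol_self]
  simp only [_root_.sum_apply, _root_.smul_apply,
    smul_eq_mul, e2, Finset.mul_sum]
  rw [Finset.sum_comm]

theorem contDiffAt_det {m : ℕ∞ω} (hg : ∀ i j, ContDiffAt ℝ m (fun y => g y i j) x) :
    ContDiffAt ℝ m (fun y => (g y).det) x := by
  simp only [Matrix.det_apply']
  exact ContDiffAt.sum fun σ _ => contDiffAt_const.mul (contDiffAt_prod fun i _ => hg _ _)

theorem contDiffAt_inv_apply {m : ℕ∞ω} (hg : ∀ i j, ContDiffAt ℝ m (fun y => g y i j) x)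
    (hdet : (g x).det ≠ 0) (i j : Fin n) : ContDiffAt ℝ m (fun y => (g y)⁻¹ i j) x := by
  have e1 : (fun y => (g y)⁻¹ i j) = fun y => ((g y).det)⁻¹ * (g y).adjugate i j := by
    ext y
    rw [Matrix.inv_def, Ring.inverse_eq_inv', Matrix.smul_apply, smul_eq_mul]
  rw [e1]
  refine ((contDiffAt_det hg).inv hdet).mul ?_
  simp only [Matrix.adjugate_apply]
  refine contDiffAt_det fun a b => ?_
  by_cases h : a = j
  · subst h
    simp only [Matrix.updateRow_self]
    exact contDiffAt_const
  · simp only [Matrix.updateRow_ne h]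
    exact hg a b

/-- Differentiate `g⁻¹ g = 1`, valid near `x` since the determinant stays nonzero there, and solve
for the derivative of `g⁻¹`. -/
theorem fderiv_inv_apply (hg : ∀ i j, DifferentiableAt ℝ (fun y => g y i j) x)
    (hi : ∀ i j, DifferentiableAt ℝ (fun y => (g y)⁻¹ i j) x)
    (hdet : (g x).det ≠ 0) (i j : Fin n) (e : E) :
    fderiv ℝ (fun y => (g y)⁻¹ i j) x e =
      - ∑ a, ∑ b, (g x)⁻¹ i a * fderiv ℝ (fun y => g y a b) x e * (g x)⁻¹ b j := by
  set D : Matrix (Fin n) (Fin n) ℝ := Matrix.of fun i j => fderiv ℝ (fun y => (g y)⁻¹ i j) x e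
  set G : Matrix (Fin n) (Fin n) ℝ := Matrix.of fun i j => fderiv ℝ (fun y => g y i j) x e
  have hcont : ContinuousAt (fun y => (g y).det) x := by
    simp only [Matrix.det_apply']
    exact tendsto_finsetSum _ fun σ _ => ContinuousAt.mul continuousAt_const
      (tendsto_finsetProd _ fun i _ => (hg _ _).continuousAt)
  have hev : ∀ᶠ y in 𝓝 x, (g y).det ≠ 0 := hcont.eventually_ne hdet
  have key : D * g x + (g x)⁻¹ * G = 0 := by
    ext a b
    have h1 : (fun y => ∑ k, (g y)⁻¹ a k * g y k b) =ᶠ[𝓝 x]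
        fun _ => (1 : Matrix (Fin n) (Fin n) ℝ) a b := by
      filter_upwards [hev] with y hy
      rw [← Matrix.mul_apply, Matrix.nonsing_inv_mul _ (isUnit_iff_ne_zero.2 hy)]
    have h2 := h1.fderiv_eq (𝕜 := ℝ)
    rw [fderiv_fun_sum (u := Finset.univ) (A := fun k y => (g y)⁻¹ a k * g y k b)
      fun k _ => (hi a k).mul (hg k b), (hasFDerivAt_const _ _).fderiv] at h2
    have h3 := congrArg (fun L : E →L[ℝ] ℝ => L e) h2
    simp only [_root_.zero_apply, _root_.sum_apply] at h3
    rw [Matrix.add_apply, Matrix.mul_apply, Matrix.mul_apply, ← Finset.sum_add_distrib,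
      Matrix.zero_apply, ← h3]
    refine Finset.sum_congr rfl fun k _ => ?_
    rw [fderiv_fun_mul (hi a k) (hg k b)]
    simp only [D, G, Matrix.of_apply, _root_.add_apply,
      _root_.smul_apply, smul_eq_mul]
    ring
  have hD : D = - ((g x)⁻¹ * G * (g x)⁻¹) := by
    have h1 : D * g x * (g x)⁻¹ = D :=
      Matrix.mul_nonsing_inv_cancel_right _ _ (isUnit_iff_ne_zero.2 hdet)
    rw [← h1, eq_neg_of_add_eq_zero_left key, Matrix.neg_mul]
  have := congrFun (congrFun hD i) j
  rw [Matrix.neg_apply, Matrix.mul_apply] at this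
  change D i j = _
  rw [this]
  congr 1
  simp only [Matrix.mul_apply, Finset.sum_mul]
  rw [Finset.sum_comm]
  rfl

/-- The algebra behind `∂ᵢ(√g gⁱᵏ)`, with `P` the inverse metric and `d i` its differentiated
components: the trace term comes from `√g`, the other from `g⁻¹`. On the Christoffel side the first
two terms agree after exchanging `i` and `j`, and the third is the trace term; only the symmetry of
`P` enters. -/
theorem christoffel_contraction {P : Matrix (Fin n) (Fin n) ℝ} (hP : P.IsSymm)
    (d : Fin n → Matrix (Fin n) (Fin n) ℝ) (k : Fin n) :
    ∑ i, ((1 / 2) * (∑ a, ∑ b, P a b * d i b a) * P i k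
      - ∑ a, ∑ b, P i a * d i a b * P b k) =
    - ∑ i, ∑ j, P i j * ((1 / 2) * ∑ l, P k l * (d i j l + d j i l - d l i j)) := by
  have hs : ∀ a b, P a b = P b a := fun a b => hP.apply b a
  have e1 : ∑ i, ∑ j, P i j * ((1 / 2) * ∑ l, P k l * (d i j l + d j i l - d l i j)) =
      (1 / 2) * (∑ i, ∑ j, ∑ l, P i j * P k l * d i j l)
      + (1 / 2) * (∑ i, ∑ j, ∑ l, P i j * P k l * d j i l)
      - (1 / 2) * (∑ i, ∑ j, ∑ l, P i j * P k l * d l i j) := by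
    simp only [Finset.mul_sum, ← Finset.sum_add_distrib, ← Finset.sum_sub_distrib]
    refine Finset.sum_congr rfl fun i _ => Finset.sum_congr rfl fun j _ =>
      Finset.sum_congr rfl fun l _ => ?_
    ring
  have e2 : ∑ i, ∑ j, ∑ l, P i j * P k l * d j i l = ∑ i, ∑ j, ∑ l, P i j * P k l * d i j l := by
    rw [Finset.sum_comm]
    refine Finset.sum_congr rfl fun i _ => Finset.sum_congr rfl fun j _ => ?_
    rw [hs i j]
  have e3 : ∑ i, ∑ j, ∑ l, P i j * P k l * d l i j =
      ∑ i, (∑ a, ∑ b, P a b * d i b a) * P i k := by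
    have : ∀ i, ∑ j, ∑ l, P i j * P k l * d l i j = ∑ l, ∑ j, P i j * P k l * d l i j :=
      fun i => Finset.sum_comm
    simp only [this]
    rw [Finset.sum_comm]
    refine Finset.sum_congr rfl fun l _ => ?_
    rw [Finset.sum_comm, Finset.sum_mul]
    refine Finset.sum_congr rfl fun a _ => ?_
    rw [Finset.sum_mul]
    refine Finset.sum_congr rfl fun b _ => ?_
    rw [hs k l, hs a b]
    ring
  have e4 : ∑ i, ∑ a, ∑ b, P i a * d i a b * P b k = ∑ i, ∑ j, ∑ l, P i j * P k l * d i j l := by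
    refine Finset.sum_congr rfl fun i _ => Finset.sum_congr rfl fun a _ =>
      Finset.sum_congr rfl fun b _ => ?_
    rw [hs b k]
    ring
  have e5 : ∑ i, (1 / 2) * (∑ a, ∑ b, P a b * d i b a) * P i k =
      (1 / 2) * ∑ i, (∑ a, ∑ b, P a b * d i b a) * P i k := by
    rw [Finset.mul_sum]
    exact Finset.sum_congr rfl fun i _ => mul_assoc _ _ _
  rw [e1, e2, e3, Finset.sum_sub_distrib, e4, e5]
  ring

/-- The identity `∂ᵢ(√|g| gⁱᵏ) = -√|g| gⁱʲ Γᵏᵢⱼ` for a smooth metric. -/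
theorem sum_fderiv_sqrt_det_mul_inv
    {g : EuclideanSpace ℝ (Fin n) → Matrix (Fin n) (Fin n) ℝ} {x : EuclideanSpace ℝ (Fin n)}
    (hg : ∀ i j, ContDiffAt ℝ ∞ (fun y => g y i j) x) (hs : (g x).IsSymm)
    (hdet : 0 < (g x).det) (k : Fin n) :
    ∑ i, fderiv ℝ (fun y => √(g y).det * (g y)⁻¹ i k) x (EuclideanSpace.single i 1) =
    - (√(g x).det * ∑ i, ∑ j, (g x)⁻¹ i j * ((1 / 2) * ∑ l, (g x)⁻¹ k l *
      (fderiv ℝ (fun y => g y j l) x (EuclideanSpace.single i 1)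
        + fderiv ℝ (fun y => g y i l) x (EuclideanSpace.single j 1)
        - fderiv ℝ (fun y => g y i j) x (EuclideanSpace.single l 1)))) := by
  have hgd : ∀ i j, DifferentiableAt ℝ (fun y => g y i j) x := fun i j =>
    (hg i j).differentiableAt (by simp)
  have hid : ∀ i j, DifferentiableAt ℝ (fun y => (g y)⁻¹ i j) x := fun i j =>
    (contDiffAt_inv_apply hg hdet.ne' i j).differentiableAt (by simp)
  have hdd := hasFDerivAt_det fun i j => (hgd i j).hasFDerivAt
  have hsq := hdd.sqrt hdet.ne'
  have hinv : ∀ a b, (g x).adjugate a b = (g x).det * (g x)⁻¹ a b := by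
    intro a b
    rw [Matrix.inv_def, Ring.inverse_eq_inv', Matrix.smul_apply, smul_eq_mul,
      mul_inv_cancel_left₀ hdet.ne']
  have hsd : √(g x).det ≠ 0 := (Real.sqrt_pos.2 hdet).ne'
  have hP : ((g x)⁻¹).IsSymm := by
    rw [Matrix.IsSymm, Matrix.transpose_nonsing_inv, hs]
  have h := christoffel_contraction hP
    (fun i => Matrix.of fun a b => fderiv ℝ (fun y => g y a b) x (EuclideanSpace.single i 1)) k
  simp only [Matrix.of_apply] at h
  rw [← mul_neg, ← h, Finset.mul_sum]
  refine Finset.sum_congr rfl fun i _ => ?_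
  rw [fderiv_fun_mul hsq.differentiableAt (hid i k), hsq.fderiv]
  simp only [_root_.add_apply, _root_.smul_apply, smul_eq_mul,
    _root_.sum_apply]
  rw [fderiv_inv_apply hgd hid hdet.ne' i k]
  have e1 : ∑ a, ∑ b, (g x).adjugate a b *
      fderiv ℝ (fun y => g y b a) x (EuclideanSpace.single i 1) =
      (g x).det * ∑ a, ∑ b, (g x)⁻¹ a b *
        fderiv ℝ (fun y => g y b a) x (EuclideanSpace.single i 1) := by
    simp only [Finset.mul_sum, hinv, mul_assoc]
  rw [e1]
  have e2 : (1 / (2 * √(g x).det)) * (g x).det = (1 / 2) * √(g x).det := by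
    nth_rewrite 2 [← Real.mul_self_sqrt hdet.le]
    field_simp
  linear_combination ((g x)⁻¹ i k * ∑ a, ∑ b, (g x)⁻¹ a b *
        fderiv ℝ (fun y => g y b a) x (EuclideanSpace.single i 1)) * e2

end MatrixCalculus

/-! ### Continuous convergence of sequences of functions -/

section ContinuousConvergence

open Filter
open scoped Topology

variable {X Y Z : Type*} [TopologicalSpace X] [TopologicalSpace Y] [TopologicalSpace Z]

/-- Continuous convergence of a sequence of functions on a set. -/
def ContinuouslyConvergesOn (F : ℕ → X → Y) (f : X → Y) (K : Set X) : Prop :=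
  ∀ x ∈ K, Tendsto (fun q : ℕ × X => F q.1 q.2) (atTop ×ˢ 𝓝 x) (𝓝 (f x))

variable {F : ℕ → X → Y} {f : X → Y} {K : Set X}

theorem ContinuouslyConvergesOn.tendsto (h : ContinuouslyConvergesOn F f K) {x : X} (hx : x ∈ K) :
    Tendsto (fun m => F m x) atTop (𝓝 (f x)) :=
  (h x hx).comp (tendsto_id.prodMk tendsto_const_nhds)

/-- The reason for using this mode of convergence: it passes through maps continuous merely at the
limit values, such as matrix inversion at invertible matrices. -/
theorem ContinuouslyConvergesOn.comp (h : ContinuouslyConvergesOn F f K) {c : Y → Z}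
    (hc : ∀ x ∈ K, ContinuousAt c (f x)) :
    ContinuouslyConvergesOn (fun m x => c (F m x)) (fun x => c (f x)) K :=
  fun x hx => (hc x hx).tendsto.comp (h x hx)

/-- Each point has a neighbourhood with a common threshold index, and finitely many cover `K`. It
makes the smoothed metrics have positive determinant on `K` from some index on. -/
theorem ContinuouslyConvergesOn.eventually_forall (h : ContinuouslyConvergesOn F f K)
    (hK : IsCompact K) {U : Set Y} (hU : IsOpen U) (hf : ∀ x ∈ K, f x ∈ U) :
    ∀ᶠ m in atTop, ∀ x ∈ K, F m x ∈ U := by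
  refine hK.induction_on (p := fun s => ∀ᶠ m in atTop, ∀ x ∈ s, F m x ∈ U) ?_ ?_ ?_ ?_
  · simp
  · intro s t hst ht
    filter_upwards [ht] with m hm x hx using hm x (hst hx)
  · intro s t hs ht
    filter_upwards [hs, ht] with m h1 h2 x hx
    exact hx.elim (h1 x) (h2 x)
  · intro x hx
    have := (h x hx).eventually (hU.mem_nhds (hf x hx))
    obtain ⟨pa, ha, pb, hb, hab⟩ := eventually_prod_iff.1 this
    exact ⟨{y | pb y}, mem_nhdsWithin_of_mem_nhds hb, ha.mono fun m hm y hy => hab hm hy⟩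

theorem ContinuouslyConvergesOn.exists_bound {F : ℕ → X → ℝ} {f : X → ℝ}
    (h : ContinuouslyConvergesOn F f K) (hK : IsCompact K) :
    ∃ B : ℝ, 0 ≤ B ∧ ∀ᶠ m in atTop, ∀ x ∈ K, |F m x| ≤ B := by
  refine hK.induction_on (p := fun s => ∃ B : ℝ, 0 ≤ B ∧ ∀ᶠ m in atTop, ∀ x ∈ s, |F m x| ≤ B)
    ?_ ?_ ?_ ?_
  · exact ⟨0, le_rfl, by simp⟩
  · rintro s t hst ⟨B, hB, ht⟩
    refine ⟨B, hB, ?_⟩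
    filter_upwards [ht] with m hm x hx using hm x (hst hx)
  · rintro s t ⟨B, hB, hs⟩ ⟨C, hC, ht⟩
    refine ⟨max B C, le_max_of_le_left hB, ?_⟩
    filter_upwards [hs, ht] with m h1 h2 x hx
    exact hx.elim (fun hx => (h1 x hx).trans (le_max_left _ _))
      fun hx => (h2 x hx).trans (le_max_right _ _)
  · intro x hx
    have := (h x hx).abs.eventually_lt_const (lt_add_one |f x|)
    obtain ⟨pa, ha, pb, hb, hab⟩ := eventually_prod_iff.1 this
    exact ⟨{y | pb y}, mem_nhdsWithin_of_mem_nhds hb, |f x| + 1, by positivity,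
      ha.mono fun m hm y hy => (hab hm hy).le⟩

end ContinuousConvergence

/-! ### Convergence of integrals with converging coefficients -/

section IntegralConvergence

open Filter
open scoped Topology

variable {X : Type*} [MeasurableSpace X] {μ : Measure X}

/-- The functions `F m` and `f` are integrable, and the integrals converge. -/
structure IntegralConverges (μ : Measure X) (F : ℕ → X → ℝ) (f : X → ℝ) : Prop where
  integrable_seq : ∀ᶠ m in atTop, Integrable (F m) μ
  integrable : Integrable f μ
  tendsto : Tendsto (fun m => ∫ x, F m x ∂μ) atTop (𝓝 (∫ x, f x ∂μ))

namespace IntegralConverges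

variable {F G : ℕ → X → ℝ} {f g : X → ℝ}

theorem add (hF : IntegralConverges μ F f) (hG : IntegralConverges μ G g) :
    IntegralConverges μ (fun m x => F m x + G m x) (fun x => f x + g x) where
  integrable_seq := by
    filter_upwards [hF.1, hG.1] with m h1 h2 using h1.add h2
  integrable := hF.2.add hG.2
  tendsto := by
    rw [integral_add hF.2 hG.2]
    refine (hF.3.add hG.3).congr' ?_
    filter_upwards [hF.1, hG.1] with m h1 h2
    rw [integral_add h1 h2]

theorem const_mul (hF : IntegralConverges μ F f) (c : ℝ) :
    IntegralConverges μ (fun m x => c * F m x) (fun x => c * f x) where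
  integrable_seq := by
    filter_upwards [hF.1] with m h1 using h1.const_mul c
  integrable := hF.2.const_mul c
  tendsto := by
    simp only [integral_const_mul]
    exact hF.3.const_mul c

theorem sub (hF : IntegralConverges μ F f) (hG : IntegralConverges μ G g) :
    IntegralConverges μ (fun m x => F m x - G m x) (fun x => f x - g x) := by
  have := hF.add (hG.const_mul (-1))
  simpa only [neg_mul, one_mul, ← sub_eq_add_neg] using this

theorem sum {ι : Type*} [Fintype ι] {F : ι → ℕ → X → ℝ} {f : ι → X → ℝ}
    (h : ∀ i, IntegralConverges μ (F i) (f i)) :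
    IntegralConverges μ (fun m x => ∑ i, F i m x) (fun x => ∑ i, f i x) where
  integrable_seq := by
    filter_upwards [eventually_all.2 fun i => (h i).1] with m hm
    exact integrable_finsetSum _ fun i _ => hm i
  integrable := integrable_finsetSum _ fun i _ => (h i).2
  tendsto := by
    rw [integral_finsetSum _ fun i _ => (h i).2]
    refine (tendsto_finsetSum _ fun i _ => (h i).3).congr' ?_
    filter_upwards [eventually_all.2 fun i => (h i).1] with m hm
    rw [integral_finsetSum _ fun i _ => hm i]

variable [TopologicalSpace X] [OpensMeasurableSpace X] {K : Set X}
  {c : ℕ → X → ℝ} {c₀ : X → ℝ}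

/-- Dominated convergence with majorant `B |h|`. Regularity of the coefficients is asked only
eventually, as inverses of smoothed metrics are regular only for large `m`. -/
theorem of_continuouslyConvergesOn (hK : IsCompact K) (hKm : MeasurableSet K)
    (hc : ContinuouslyConvergesOn c c₀ K) (hcm : ∀ᶠ m in atTop, ContinuousOn (c m) K)
    {h : X → ℝ} (hh : Integrable h (μ.restrict K)) :
    IntegralConverges (μ.restrict K) (fun m x => c m x * h x) (fun x => c₀ x * h x) := by
  obtain ⟨B, hB0, hB⟩ := hc.exists_bound hK
  have hmeas : ∀ᶠ m in atTop, AEStronglyMeasurable (c m) (μ.restrict K) := by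
    filter_upwards [hcm] with m hm using hm.aestronglyMeasurable_of_isCompact hK hKm
  have hlim : ∀ᵐ x ∂(μ.restrict K), Tendsto (fun m => c m x) atTop (𝓝 (c₀ x)) := by
    filter_upwards [ae_restrict_mem hKm] with x hx using hc.tendsto hx
  -- Shifting by `m₀` makes every term measurable, hence also the limit `c₀`.
  obtain ⟨m₀, hm₀⟩ := eventually_atTop.1 (hmeas.and hB)
  have hmeas0 : AEStronglyMeasurable c₀ (μ.restrict K) := by
    refine aestronglyMeasurable_of_tendsto_ae (u := atTop) (f := fun m => c (m + m₀))
      (fun m => (hm₀ (m + m₀) (Nat.le_add_left _ _)).1) ?_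
    filter_upwards [hlim] with x hx using hx.comp (tendsto_add_atTop_nat m₀)
  have hb0 : ∀ᵐ x ∂(μ.restrict K), ‖c₀ x‖ ≤ B := by
    filter_upwards [ae_restrict_mem hKm] with x hx
    refine le_of_tendsto (hc.tendsto hx).abs ?_
    filter_upwards [hB] with m hm using hm x hx
  refine ⟨?_, hh.bdd_mul hmeas0 hb0, ?_⟩
  · filter_upwards [hmeas, hB] with m h1 h2
    refine hh.bdd_mul (c := B) h1 ?_
    filter_upwards [ae_restrict_mem hKm] with x hx using h2 x hx
  · refine tendsto_integral_filter_of_dominated_convergence (fun x => B * ‖h x‖) ?_ ?_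
      (hh.norm.const_mul B) ?_
    · filter_upwards [hmeas] with m h1 using h1.mul hh.1
    · filter_upwards [hB] with m hm
      filter_upwards [ae_restrict_mem hKm] with x hx
      rw [norm_mul]
      gcongr
      exact hm x hx
    · filter_upwards [hlim] with x hx using hx.mul_const _

/-- Split `F m = f + (F m - f)`. The first part is dominated convergence against `f h`, which is in
`L¹`; the second is at most `B ‖F m - f‖₂ ‖h‖₂` by Hölder. -/
theorem of_continuouslyConvergesOn_of_eLpNorm (hK : IsCompact K) (hKm : MeasurableSet K)
    (hc : ContinuouslyConvergesOn c c₀ K) (hcm : ∀ᶠ m in atTop, ContinuousOn (c m) K)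
    {F : ℕ → X → ℝ} {f h : X → ℝ} (hF : ∀ m, MemLp (F m) 2 (μ.restrict K))
    (hf : MemLp f 2 (μ.restrict K)) (hh : MemLp h 2 (μ.restrict K))
    (hFf : Tendsto (fun m => eLpNorm (F m - f) 2 (μ.restrict K)) atTop (𝓝 0)) :
    IntegralConverges (μ.restrict K) (fun m x => c m x * (F m x * h x))
      (fun x => c₀ x * (f x * h x)) := by
  have h1 : IntegralConverges (μ.restrict K) (fun m x => c m x * (f x * h x))
      (fun x => c₀ x * (f x * h x)) :=
    of_continuouslyConvergesOn hK hKm hc hcm (hf.integrable_mul hh)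
  have h2 : IntegralConverges (μ.restrict K) (fun m x => c m x * ((F m x - f x) * h x))
      (fun _ => 0) := by
    obtain ⟨B, hB0, hB⟩ := hc.exists_bound hK
    have hi : ∀ m, Integrable (fun x => (F m x - f x) * h x) (μ.restrict K) := fun m =>
      ((hF m).sub hf).integrable_mul hh
    refine ⟨?_, integrable_zero _ _ _, ?_⟩
    · filter_upwards [hcm, hB] with m h3 h4
      refine (hi m).bdd_mul (c := B) (h3.aestronglyMeasurable_of_isCompact hK hKm) ?_
      filter_upwards [ae_restrict_mem hKm] with x hx using h4 x hx
    · rw [integral_zero]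
      have hb : ∀ᶠ m in atTop, ‖∫ x, c m x * ((F m x - f x) * h x) ∂(μ.restrict K)‖ₑ ≤
          ENNReal.ofReal B * (eLpNorm (F m - f) 2 (μ.restrict K) *
            eLpNorm h 2 (μ.restrict K)) := by
        filter_upwards [hB] with m hm
        calc _ ≤ ∫⁻ x, ‖c m x * ((F m x - f x) * h x)‖ₑ ∂(μ.restrict K) :=
              enorm_integral_le_lintegral_enorm _
          _ ≤ ∫⁻ x, ENNReal.ofReal B * ‖((F m - f) x) • h x‖ₑ ∂(μ.restrict K) := by
              refine lintegral_mono_ae ?_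
              filter_upwards [ae_restrict_mem hKm] with x hx
              rw [enorm_mul, Pi.sub_apply, smul_eq_mul]
              gcongr
              rw [← ofReal_norm]
              exact ENNReal.ofReal_le_ofReal (hm x hx)
          _ = ENNReal.ofReal B * eLpNorm ((F m - f) • h) 1 (μ.restrict K) := by
              rw [lintegral_const_mul' _ _ ENNReal.ofReal_ne_top, eLpNorm_one_eq_lintegral_enorm]
              rfl
          _ ≤ _ := by
              gcongr
              exact eLpNorm_smul_le_mul_eLpNorm hh.1 ((hF m).sub hf).1
      have hz : Tendsto (fun m => ENNReal.ofReal B * (eLpNorm (F m - f) 2 (μ.restrict K) *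
            eLpNorm h 2 (μ.restrict K))) atTop (𝓝 0) := by
        have := ENNReal.Tendsto.const_mul (a := ENNReal.ofReal B)
          (ENNReal.Tendsto.mul_const (b := eLpNorm h 2 (μ.restrict K)) hFf
          (Or.inr hh.eLpNorm_ne_top)) (Or.inr ENNReal.ofReal_ne_top)
        simpa using this
      rw [tendsto_iff_enorm_sub_tendsto_zero]
      simp only [sub_zero]
      exact tendsto_of_tendsto_of_tendsto_of_le_of_le' tendsto_const_nhds hz
        (Eventually.of_forall fun _ => zero_le) hb
  refine ⟨?_, h1.2, ?_⟩
  · filter_upwards [(h1.add h2).1] with m hm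
    refine hm.congr (Eventually.of_forall fun x => ?_)
    dsimp only
    ring
  · have := (h1.add h2).3
    simp only [add_zero] at this
    refine this.congr fun m => ?_
    refine integral_congr_ae (Eventually.of_forall fun x => ?_)
    dsimp only
    ring

end IntegralConverges

end IntegralConvergence

/-! ### Smoothing operators -/

section Approximation

open Filter Metric
open scoped Topology Convolution

variable {n : ℕ} {Ω : Set (EuclideanSpace ℝ (Fin n))}

/-- Linear smoothing operators near a compact subset of an open set. -/
theorem exists_smoothing_operators (hΩ : IsOpen Ω) {K : Set (EuclideanSpace ℝ (Fin n))}
    (hK : IsCompact K) (hKΩ : K ⊆ Ω) :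
    ∃ T : ℕ → (EuclideanSpace ℝ (Fin n) → ℝ) → EuclideanSpace ℝ (Fin n) → ℝ,
      (∀ m u v, EqOn u v Ω → T m u = T m v) ∧
      (∀ u, ContinuousOn u Ω → (∀ m, ContDiff ℝ ∞ (T m u)) ∧
        ContinuouslyConvergesOn (fun m => T m u) u K) ∧
      ∀ u v i, IsWeakPartial Ω i u v →
        (∀ K ⊆ Ω, IsCompact K → MemLp v 2 (volume.restrict K)) →
        Tendsto (fun m => eLpNorm
          ((fun x => fderiv ℝ (T m u) x (EuclideanSpace.single i 1)) - v) 2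
            (volume.restrict K)) atTop (𝓝 0) := by
  obtain ⟨δ, hδ0, hδ⟩ := hK.exists_cthickening_subset_open hΩ hKΩ
  set K' := cthickening δ K
  have hK' : IsCompact K' := hK.cthickening
  have hball : ∀ x ∈ K, closedBall x δ ⊆ K' := fun x hx => closedBall_subset_cthickening hx δ
  set φ : ℕ → ContDiffBump (0 : EuclideanSpace ℝ (Fin n)) := shrinkingBump δ hδ0
  -- Mollification of `u` cut off to `K' ⊆ Ω`, so that only values on `Ω` matter. That locality
  -- keeps the smoothed metric symmetric although `g` is symmetric only on `Ω`.
  refine ⟨fun m u => (φ m).normed volume ⋆[ContinuousLinearMap.lsmul ℝ ℝ, volume]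
    (K'.indicator u), ?_, ?_, ?_⟩
  · intro m u v huv
    have : K'.indicator u = K'.indicator v := indicator_congr fun x hx => huv (hδ hx)
    simp only [this]
  · intro u hu
    have hui : Integrable (K'.indicator u) := by
      rw [integrable_indicator_iff hK'.measurableSet]
      exact (hu.mono hδ).integrableOn_compact hK'
    refine ⟨fun m => (φ m).hasCompactSupport_normed.contDiff_convolution_left _
      (φ m).contDiff_normed hui.locallyIntegrable, fun x hx => ?_⟩
    have hxK : K' ∈ 𝓝 x := mem_of_superset (closedBall_mem_nhds x hδ0) (hball x hx)
    have hcx : ContinuousAt (K'.indicator u) x := by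
      refine (hu.continuousAt (hΩ.mem_nhds (hKΩ hx))).congr ?_
      filter_upwards [hxK] with y hy
      rw [indicator_of_mem hy]
    have := ContDiffBump.convolution_tendsto_right (μ := volume) (l := atTop ×ˢ 𝓝 x)
      (φ := fun q : ℕ × EuclideanSpace ℝ (Fin n) => φ q.1) (g := fun _ => K'.indicator u)
      (k := fun q => q.2) (x₀ := x) (z₀ := K'.indicator u x)
      ((tendsto_shrinkingBump_rOut hδ0).comp tendsto_fst)
      (Eventually.of_forall fun _ => hui.1) (hcx.tendsto.comp tendsto_snd) tendsto_snd
    rwa [indicator_of_mem (mem_of_mem_nhds hxK)] at this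
  · intro u v i huv hv
    have hvi : MemLp (K'.indicator v) 2 := by
      rw [memLp_indicator_iff_restrict hK'.measurableSet]
      exact hv K' hδ hK'
    have h1 := hvi.tendsto_eLpNorm_normed_convolution_sub (μ := volume)
      (tendsto_shrinkingBump_rOut hδ0) (by norm_num) (by norm_num)
    refine tendsto_of_tendsto_of_tendsto_of_le_of_le tendsto_const_nhds h1
      (fun _ => zero_le) fun m => ?_
    refine le_trans (le_of_eq (eLpNorm_congr_ae ?_)) (eLpNorm_restrict_le _ _ _ K)
    filter_upwards [ae_restrict_mem hK.measurableSet] with x hx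
    have hx' : closedBall x (φ m).rOut ⊆ K' :=
      (closedBall_subset_closedBall (shrinkingBump_rOut_le hδ0 m)).trans (hball x hx)
    rw [Pi.sub_apply, Pi.sub_apply, huv.fderiv_normed_convolution (φ m) hK' hδ hx',
      indicator_of_mem (hball x hx (mem_closedBall_self hδ0.le))]

end Approximation

/-! ### Divergence form of the Laplacian in a chart -/

section Divergence

open Filter Metric
open scoped Topology

variable {n : ℕ} {Ω : Set (EuclideanSpace ℝ (Fin n))}

theorem continuousAt_inv_apply {A : Matrix (Fin n) (Fin n) ℝ} (hA : A.det ≠ 0) (i j : Fin n) :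
    ContinuousAt (fun B : Matrix (Fin n) (Fin n) ℝ => B⁻¹ i j) A := by
  simp only [Matrix.inv_def, Ring.inverse_eq_inv', Matrix.smul_apply, smul_eq_mul]
  exact (Continuous.continuousAt (by fun_prop)).inv₀ hA |>.mul
    (Continuous.continuousAt (Continuous.matrix_elem (by fun_prop) i j))

theorem continuousAt_sqrt_det {A : Matrix (Fin n) (Fin n) ℝ} :
    ContinuousAt (fun B : Matrix (Fin n) (Fin n) ℝ => √B.det) A :=
  Continuous.continuousAt (by fun_prop)

/-- Applied to the metric components and to `u`, so that products of their first derivatives are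
integrable. -/
theorem MemW2Loc.memLp_two {p : ℝ} {u : EuclideanSpace ℝ (Fin n) → ℝ} (hu : MemW2Loc Ω p u)
    (hn : 3 ≤ n) (hΩ : IsOpen Ω) (hp : (n : ℝ) / 2 < p) (i : Fin n) :
    ∀ K ⊆ Ω, IsCompact K → MemLp (weakPartial Ω i u) 2 (volume.restrict K) := fun _ hKΩ hK =>
  memLp_two_restrict_of_isWeakPartial hn hΩ hp (hu.memLp_first i)
    (fun j => isWeakPartial_weakPartial (hu.exists_second i j)) (hu.memLp_second i) hKΩ hK

/-- Integration of `∂ᵢ(A ψ wₖ)`, where `w` is weakly differentiable and `A` is smooth. -/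
theorem IsWeakPartial.integral_smooth_mul_eq_zero {i : Fin n}
    {w s A ψ : EuclideanSpace ℝ (Fin n) → ℝ} (h : IsWeakPartial Ω i w s)
    (hψ : ContDiff ℝ ∞ ψ) (hψc : HasCompactSupport ψ) (hψs : tsupport ψ ⊆ Ω)
    (hA : ∀ x ∈ tsupport ψ, ContDiffAt ℝ ∞ A x) :
    IntegrableOn (fun y => A y * (fderiv ℝ ψ y (EuclideanSpace.single i 1) * w y)
      + A y * (ψ y * s y) + fderiv ℝ A y (EuclideanSpace.single i 1) * (ψ y * w y))
      (tsupport ψ) ∧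
    ∫ y in tsupport ψ, (A y * (fderiv ℝ ψ y (EuclideanSpace.single i 1) * w y)
      + A y * (ψ y * s y) + fderiv ℝ A y (EuclideanSpace.single i 1) * (ψ y * w y)) = 0 := by
  set e : EuclideanSpace ℝ (Fin n) := EuclideanSpace.single i 1
  have hK : IsCompact (tsupport ψ) := hψc
  -- The product `A ψ` is itself the test function; smoothness of `A` on the support of `ψ`
  -- suffices.
  have hθ : ContDiff ℝ ∞ fun y => A y * ψ y := contDiff_of_contDiffAt_tsupport fun x hx =>
    (hA x (tsupport_mul_subset_right (f := A) (g := ψ) hx)).mul hψ.contDiffAt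
  have hθK : tsupport (fun y => A y * ψ y) ⊆ tsupport ψ :=
    tsupport_mul_subset_right (f := A) (g := ψ)
  have hθs := hθK.trans hψs
  have hθc : HasCompactSupport fun y => A y * ψ y := hψc.mul_left
  have hw := h.1.integrableOn_compact_subset hψs hK
  have hs := h.2.1.integrableOn_compact_subset hψs hK
  have key := h.2.2 _ hθ hθc hθs
  have i1 : IntegrableOn (fun y => w y * fderiv ℝ (fun y => A y * ψ y) y e) (tsupport ψ) :=
    hw.mul_continuousOn ((hθ.continuous_fderiv (by simp)).clm_apply continuous_const).continuousOn
      hK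
  have i2 : IntegrableOn (fun y => s y * (A y * ψ y)) (tsupport ψ) :=
    hs.mul_continuousOn hθ.continuous.continuousOn hK
  have hder : ∀ y ∈ tsupport ψ, fderiv ℝ (fun y => A y * ψ y) y e =
      A y * fderiv ℝ ψ y e + ψ y * fderiv ℝ A y e := by
    intro y hy
    rw [fderiv_fun_mul ((hA y hy).differentiableAt (by simp)) (hψ.differentiable (by simp) y)]
    simp
  have hpt : ∀ y ∈ tsupport ψ, w y * fderiv ℝ (fun y => A y * ψ y) y e + s y * (A y * ψ y) =
      A y * (fderiv ℝ ψ y e * w y) + A y * (ψ y * s y) + fderiv ℝ A y e * (ψ y * w y) := by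
    intro y hy
    rw [hder y hy]
    ring
  refine ⟨(i1.add i2).congr_fun hpt hK.measurableSet, ?_⟩
  rw [← setIntegral_congr_fun hK.measurableSet hpt, integral_add i1 i2]
  have e1 : ∫ y in tsupport ψ, w y * fderiv ℝ (fun y => A y * ψ y) y e =
      ∫ y in Ω, w y * fderiv ℝ (fun y => A y * ψ y) y e := by
    rw [setIntegral_mul_fderiv_eq_integral_of_tsupport_subset hθs,
      setIntegral_mul_fderiv_eq_integral_of_tsupport_subset hθK]
  have e2 : ∫ y in tsupport ψ, s y * (A y * ψ y) = ∫ y in Ω, s y * (A y * ψ y) := by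
    rw [setIntegral_mul_eq_integral_of_tsupport_subset hθs,
      setIntegral_mul_eq_integral_of_tsupport_subset hθK]
  rw [e1, e2, key]
  simp

/-- Weak form of the Laplace operator of a `W^{2,p}` metric, `p > n / 2`, in coordinates. -/
theorem setIntegral_sqrt_det_mul_coordLaplacian (hn : 3 ≤ n) (hΩ : IsOpen Ω) {p : ℝ}
    (hp : (n : ℝ) / 2 < p) {g : EuclideanSpace ℝ (Fin n) → Matrix (Fin n) (Fin n) ℝ}
    (hgc : ∀ i j, ContinuousOn (fun y => g y i j) Ω) (hgs : ∀ y ∈ Ω, (g y).IsSymm)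
    (hgd : ∀ y ∈ Ω, 0 < (g y).det) (hgW : ∀ i j, MemW2Loc Ω p fun y => g y i j)
    {u : EuclideanSpace ℝ (Fin n) → ℝ} (hu : MemW2Loc Ω p u)
    {ψ : EuclideanSpace ℝ (Fin n) → ℝ} (hψ : ContDiff ℝ ∞ ψ) (hψc : HasCompactSupport ψ)
    (hψs : tsupport ψ ⊆ Ω) :
    IntegrableOn (fun y => √(g y).det * coordLaplacian Ω g u y * ψ y) (tsupport ψ) ∧
    ∫ y in tsupport ψ, √(g y).det * coordLaplacian Ω g u y * ψ y =
      - ∫ y in tsupport ψ, ∑ i, ∑ j, √(g y).det * (g y)⁻¹ i j *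
        (fderiv ℝ ψ y (EuclideanSpace.single i 1) * weakPartial Ω j u y) := by
  set K := tsupport ψ
  have hK : IsCompact K := hψc
  obtain ⟨T, hT1, hT2, hT3⟩ := exists_smoothing_operators hΩ hK hψs
  -- Only the metric is smoothed, entry by entry; `u` and its weak derivatives remain untouched.
  set G : ℕ → EuclideanSpace ℝ (Fin n) → Matrix (Fin n) (Fin n) ℝ :=
    fun m y => Matrix.of fun i j => T m (fun y => g y i j) y
  have hGs : ∀ m y, (G m y).IsSymm := by
    intro m y
    refine Matrix.IsSymm.ext fun i j => ?_
    have := hT1 m (fun y => g y j i) (fun y => g y i j) fun z hz => (hgs z hz).apply i j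
    exact congrFun this y
  have hGd : ∀ m i j, ContDiff ℝ ∞ fun y => G m y i j := fun m i j => (hT2 _ (hgc i j)).1 m
  have hGg : ContinuouslyConvergesOn G g K := fun x hx =>
    tendsto_pi_nhds.2 fun i => tendsto_pi_nhds.2 fun j => (hT2 _ (hgc i j)).2 x hx
  have hdet : ∀ᶠ m in atTop, ∀ x ∈ K, 0 < (G m x).det :=
    (hGg.comp (c := Matrix.det) fun x _ => Continuous.continuousAt (by fun_prop)).eventually_forall
      hK isOpen_Ioi fun x hx => hgd x (hψs hx)
  set D : Fin n → Fin n → Fin n → EuclideanSpace ℝ (Fin n) → ℝ :=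
    fun l i j => weakPartial Ω l (fun y => g y i j)
  have hD2 : ∀ l i j, MemLp (D l i j) 2 (volume.restrict K) := fun l i j =>
    (hgW i j).memLp_two hn hΩ hp l K hψs hK
  set dG : Fin n → Fin n → Fin n → ℕ → EuclideanSpace ℝ (Fin n) → ℝ :=
    fun l i j m y => fderiv ℝ (fun y => G m y i j) y (EuclideanSpace.single l 1)
  have hdGD : ∀ l i j, Tendsto (fun m => eLpNorm (dG l i j m - D l i j) 2 (volume.restrict K))
      atTop (𝓝 0) := fun l i j =>
    hT3 _ _ l (isWeakPartial_weakPartial ((hgW i j).exists_first l))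
      ((hgW i j).memLp_two hn hΩ hp l)
  have hdGL : ∀ l i j m, MemLp (dG l i j m) 2 (volume.restrict K) := by
    intro l i j m
    have hc : Continuous (dG l i j m) :=
      ((hGd m i j).continuous_fderiv (by simp)).clm_apply continuous_const
    obtain ⟨C, hC⟩ := hK.exists_bound_of_continuousOn hc.continuousOn
    have : IsFiniteMeasure (volume.restrict K) := ⟨by simpa using hK.measure_lt_top⟩
    refine MemLp.of_bound hc.aestronglyMeasurable C ?_
    filter_upwards [ae_restrict_mem hK.measurableSet] with x hx using hC x hx
  have hSP : ∀ i j, IsWeakPartial Ω i (weakPartial Ω j u) (weakPartial Ω i (weakPartial Ω j u)) :=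
    fun i j => isWeakPartial_weakPartial (hu.exists_second j i)
  have hψK : ContinuousOn ψ K := hψ.continuous.continuousOn
  have hwi : ∀ k, IntegrableOn (weakPartial Ω k u) K := fun k =>
    ((isWeakPartial_weakPartial (hu.exists_first k)).2.1).integrableOn_compact_subset hψs hK
  have hh1 : ∀ i k, IntegrableOn (fun y => fderiv ℝ ψ y (EuclideanSpace.single i 1) *
      weakPartial Ω k u y) K := fun i k =>
    (hwi k).continuousOn_mul
      ((hψ.continuous_fderiv (by simp)).clm_apply continuous_const).continuousOn hK
  have hh2 : ∀ i k, IntegrableOn (fun y => ψ y * weakPartial Ω i (weakPartial Ω k u) y) K :=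
    fun i k => ((hSP i k).2.1.integrableOn_compact_subset hψs hK).continuousOn_mul hψK hK
  have hh3 : ∀ k, MemLp (fun y => ψ y * weakPartial Ω k u y) 2 (volume.restrict K) := by
    intro k
    obtain ⟨C, hC⟩ := hψc.exists_bound_of_continuous hψ.continuous
    refine (hu.memLp_two hn hΩ hp k K hψs hK).of_le_mul (c := C)
      (hψ.continuous.aestronglyMeasurable.mul (hu.memLp_two hn hΩ hp k K hψs hK).1) ?_
    refine Eventually.of_forall fun y => ?_
    rw [norm_mul]
    gcongr
    exact hC y
  have hsm : ∀ᶠ m in atTop, ∀ i k, ∀ x ∈ K,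
      ContDiffAt ℝ ∞ (fun y => √(G m y).det * (G m y)⁻¹ i k) x := by
    filter_upwards [hdet] with m hm i k x hx
    exact ((contDiffAt_det fun i j => (hGd m i j).contDiffAt).sqrt (hm x hx).ne').mul
      (contDiffAt_inv_apply (fun i j => (hGd m i j).contDiffAt) (hm x hx).ne' i k)
  have hsmi : ∀ᶠ m in atTop, ∀ i k, ContinuousOn (fun y => (G m y)⁻¹ i k) K := by
    filter_upwards [hdet] with m hm i k x hx
    exact (contDiffAt_inv_apply (m := ∞) (fun i j => (hGd m i j).contDiffAt)
      (hm x hx).ne' i k).continuousAt.continuousWithinAt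
  have hcA : ∀ i k, ContinuouslyConvergesOn (fun m y => √(G m y).det * (G m y)⁻¹ i k)
      (fun y => √(g y).det * (g y)⁻¹ i k) K := fun i k =>
    hGg.comp (c := fun B => √B.det * B⁻¹ i k) fun x hx =>
      continuousAt_sqrt_det.mul (continuousAt_inv_apply (hgd x (hψs hx)).ne' i k)
  have hcB : ∀ i j k l, ContinuouslyConvergesOn
      (fun m y => √(G m y).det * (G m y)⁻¹ i j * (G m y)⁻¹ k l)
      (fun y => √(g y).det * (g y)⁻¹ i j * (g y)⁻¹ k l) K := fun i j k l =>
    hGg.comp (c := fun B => √B.det * B⁻¹ i j * B⁻¹ k l) fun x hx =>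
      (continuousAt_sqrt_det.mul (continuousAt_inv_apply (hgd x (hψs hx)).ne' i j)).mul
        (continuousAt_inv_apply (hgd x (hψs hx)).ne' k l)
  have hcAc : ∀ i k, ∀ᶠ m in atTop, ContinuousOn
      (fun y => √(G m y).det * (G m y)⁻¹ i k) K := by
    intro i k
    filter_upwards [hsm] with m hm x hx using (hm i k x hx).continuousAt.continuousWithinAt
  have hcBc : ∀ i j k l, ∀ᶠ m in atTop, ContinuousOn
      (fun y => √(G m y).det * (G m y)⁻¹ i j * (G m y)⁻¹ k l) K := by
    intro i j k l
    filter_upwards [hcAc i j, hsmi] with m h1 h2 using h1.mul (h2 k l)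
  -- Limits of the three groups of terms: `∂ψ ∂u`, `ψ ∂∂u`, and the Christoffel terms `ψ ∂g ∂u`. The
  -- last needs the `L²` version.
  have I1 := IntegralConverges.sum fun i => IntegralConverges.sum fun k =>
    IntegralConverges.of_continuouslyConvergesOn hK hK.measurableSet (hcA i k) (hcAc i k)
      (hh1 i k)
  have I2 := IntegralConverges.sum fun i => IntegralConverges.sum fun k =>
    IntegralConverges.of_continuouslyConvergesOn hK hK.measurableSet (hcA i k) (hcAc i k)
      (hh2 i k)
  have J : ∀ i j k l a b c, IntegralConverges (volume.restrict K)
      (fun m y => √(G m y).det * (G m y)⁻¹ i j * (G m y)⁻¹ k l *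
        (dG a b c m y * (ψ y * weakPartial Ω k u y)))
      (fun y => √(g y).det * (g y)⁻¹ i j * (g y)⁻¹ k l *
        (D a b c y * (ψ y * weakPartial Ω k u y))) := fun i j k l a b c =>
    IntegralConverges.of_continuouslyConvergesOn_of_eLpNorm hK hK.measurableSet (hcB i j k l)
      (hcBc i j k l) (hdGL a b c) (hD2 a b c) (hh3 k) (hdGD a b c)
  have I3 := IntegralConverges.sum fun k => IntegralConverges.sum fun i =>
    IntegralConverges.sum fun j => IntegralConverges.sum fun l =>
    (((J i j k l i j l).add (J i j k l j i l)).sub (J i j k l l i j)).const_mul (1 / 2)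
  have hI := I1.add (I2.sub I3)
  -- For a smoothed metric, integrate `∂ᵢ(√G Gⁱᵏ ψ ∂ₖu)` to zero, sum over `i` and `k`, and replace
  -- `∂ᵢ(√G Gⁱᵏ)` by its Christoffel expression.
  have hzero : ∀ᶠ m in atTop, ∫ y in K,
      (∑ i, ∑ k, √(G m y).det * (G m y)⁻¹ i k *
        (fderiv ℝ ψ y (EuclideanSpace.single i 1) * weakPartial Ω k u y) +
      (∑ i, ∑ k, √(G m y).det * (G m y)⁻¹ i k *
        (ψ y * weakPartial Ω i (weakPartial Ω k u) y) -
      ∑ k, ∑ i, ∑ j, ∑ l, 1 / 2 * (√(G m y).det * (G m y)⁻¹ i j * (G m y)⁻¹ k l *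
        (dG i j l m y * (ψ y * weakPartial Ω k u y)) +
        √(G m y).det * (G m y)⁻¹ i j * (G m y)⁻¹ k l *
        (dG j i l m y * (ψ y * weakPartial Ω k u y)) -
        √(G m y).det * (G m y)⁻¹ i j * (G m y)⁻¹ k l *
        (dG l i j m y * (ψ y * weakPartial Ω k u y))))) = 0 := by
    filter_upwards [hdet, hsm] with m hm hsm'
    have hq := fun i k => (hSP i k).integral_smooth_mul_eq_zero hψ hψc hψs (hsm' i k)
    have hqs : ∫ y in K, ∑ i, ∑ k,
        (√(G m y).det * (G m y)⁻¹ i k *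
          (fderiv ℝ ψ y (EuclideanSpace.single i 1) * weakPartial Ω k u y)
        + √(G m y).det * (G m y)⁻¹ i k * (ψ y * weakPartial Ω i (weakPartial Ω k u) y)
        + fderiv ℝ (fun y => √(G m y).det * (G m y)⁻¹ i k) y (EuclideanSpace.single i 1) *
          (ψ y * weakPartial Ω k u y)) = 0 := by
      rw [integral_finsetSum _ fun i _ => integrable_finsetSum _ fun k _ => (hq i k).1]
      refine Finset.sum_eq_zero fun i _ => ?_
      rw [integral_finsetSum _ fun k _ => (hq i k).1]
      exact Finset.sum_eq_zero fun k _ => (hq i k).2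
    rw [← hqs]
    refine setIntegral_congr_fun hK.measurableSet fun y hy => ?_
    have hid := fun k => sum_fderiv_sqrt_det_mul_inv (fun i j => (hGd m i j).contDiffAt (x := y))
      (hGs m y) (hm y hy) k
    have e1 : ∑ i, ∑ k, fderiv ℝ (fun y => √(G m y).det * (G m y)⁻¹ i k) y
        (EuclideanSpace.single i 1) * (ψ y * weakPartial Ω k u y) =
        - ∑ k, ∑ i, ∑ j, ∑ l, 1 / 2 * (√(G m y).det * (G m y)⁻¹ i j * (G m y)⁻¹ k l *
        (dG i j l m y * (ψ y * weakPartial Ω k u y)) +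
        √(G m y).det * (G m y)⁻¹ i j * (G m y)⁻¹ k l *
        (dG j i l m y * (ψ y * weakPartial Ω k u y)) -
        √(G m y).det * (G m y)⁻¹ i j * (G m y)⁻¹ k l *
        (dG l i j m y * (ψ y * weakPartial Ω k u y))) := by
      rw [Finset.sum_comm, ← Finset.sum_neg_distrib]
      refine Finset.sum_congr rfl fun k _ => ?_
      rw [← Finset.sum_mul, hid k, neg_mul, neg_inj]
      simp only [Finset.mul_sum, Finset.sum_mul]
      refine Finset.sum_congr rfl fun i _ => Finset.sum_congr rfl fun j _ =>
        Finset.sum_congr rfl fun l _ => ?_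
      simp only [dG]
      ring
    simp only [Finset.sum_add_distrib]
    rw [e1]
    ring
  have hlim0 := tendsto_nhds_unique hI.tendsto
    (tendsto_const_nhds.congr' (hzero.mono fun m hm => hm.symm))
  -- The nondivergence Laplacian is exactly the limit integrand of the second group minus the third.
  have hLap : ∀ y, √(g y).det * coordLaplacian Ω g u y * ψ y =
      ∑ i, ∑ k, √(g y).det * (g y)⁻¹ i k * (ψ y * weakPartial Ω i (weakPartial Ω k u) y) -
      ∑ k, ∑ i, ∑ j, ∑ l, 1 / 2 * (√(g y).det * (g y)⁻¹ i j * (g y)⁻¹ k l *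
        (D i j l y * (ψ y * weakPartial Ω k u y)) +
        √(g y).det * (g y)⁻¹ i j * (g y)⁻¹ k l *
        (D j i l y * (ψ y * weakPartial Ω k u y)) -
        √(g y).det * (g y)⁻¹ i j * (g y)⁻¹ k l *
        (D l i j y * (ψ y * weakPartial Ω k u y))) := by
    intro y
    rw [coordLaplacian]
    have e2 : ∀ F : Fin n → Fin n → Fin n → ℝ,
        ∑ k, ∑ i, ∑ j, F k i j = ∑ i, ∑ j, ∑ k, F k i j := by
      intro F
      rw [Finset.sum_comm]
      exact Finset.sum_congr rfl fun i _ => Finset.sum_comm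
    rw [e2]
    simp only [coordChristoffel, ← Finset.sum_sub_distrib, Finset.mul_sum, Finset.sum_mul]
    refine Finset.sum_congr rfl fun i _ => Finset.sum_congr rfl fun j _ => ?_
    rw [mul_sub, mul_sub, sub_mul]
    simp only [Finset.mul_sum, Finset.sum_mul]
    congr 1
    · ring
    · refine Finset.sum_congr rfl fun k _ => Finset.sum_congr rfl fun l _ => ?_
      simp only [D]
      ring
  have hI23 := I2.sub I3
  have hfun : (fun y => √(g y).det * coordLaplacian Ω g u y * ψ y) = _ := funext hLap
  rw [hfun]
  refine ⟨hI23.integrable, ?_⟩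
  rw [eq_neg_iff_add_eq_zero, add_comm, ← integral_add I1.integrable hI23.integrable]
  exact hlim0

end Divergence

/-! ### Weak derivatives under smooth changes of variables -/

section ChangeOfVariables

open Filter Metric
open scoped Topology

variable {n : ℕ}

theorem clm_apply_eq_sum (L : EuclideanSpace ℝ (Fin n) →L[ℝ] ℝ) (x : EuclideanSpace ℝ (Fin n)) :
    L x = ∑ k, x k * L (EuclideanSpace.single k 1) := by
  have hx : x = ∑ i, x i • EuclideanSpace.single i (1 : ℝ) := by
    ext j
    simp [Finset.sum_apply, Pi.single_apply]
  conv_lhs => rw [hx]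
  simp [map_sum]

/-- The matrix of a linear endomorphism in the standard basis. -/
def jacobianMatrix (L : EuclideanSpace ℝ (Fin n) →L[ℝ] EuclideanSpace ℝ (Fin n)) :
    Matrix (Fin n) (Fin n) ℝ :=
  Matrix.of fun k i => L (EuclideanSpace.single i 1) k

theorem det_jacobianMatrix (L : EuclideanSpace ℝ (Fin n) →L[ℝ] EuclideanSpace ℝ (Fin n)) :
    (jacobianMatrix L).det = L.det := by
  rw [ContinuousLinearMap.det, ← LinearMap.det_toMatrix (EuclideanSpace.basisFun (Fin n) ℝ).toBasis]
  congr 1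

theorem ContDiffAt.fderiv_apply_apply {τ : EuclideanSpace ℝ (Fin n) → EuclideanSpace ℝ (Fin n)}
    {y : EuclideanSpace ℝ (Fin n)} (h : ContDiffAt ℝ ∞ τ y) (e : EuclideanSpace ℝ (Fin n))
    (k : Fin n) : ContDiffAt ℝ ∞ (fun y => fderiv ℝ τ y e k) y := by
  have h1 : ContDiffAt ℝ ∞ (fun y => fderiv ℝ τ y e) y :=
    (h.fderiv_right (m := ∞) (by simp)).clm_apply contDiffAt_const
  exact contDiffAt_euclidean.1 h1 k

theorem ContDiffAt.abs_det_fderiv {τ : EuclideanSpace ℝ (Fin n) → EuclideanSpace ℝ (Fin n)}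
    {y : EuclideanSpace ℝ (Fin n)} (h : ContDiffAt ℝ ∞ τ y) (h0 : (fderiv ℝ τ y).det ≠ 0) :
    ContDiffAt ℝ ∞ (fun y => |(fderiv ℝ τ y).det|) y := by
  have h1 : ContDiffAt ℝ ∞ (fun y => (fderiv ℝ τ y).det) y := by
    simp only [← det_jacobianMatrix]
    exact contDiffAt_det fun i j => h.fderiv_apply_apply (EuclideanSpace.single j 1) i
  exact (contDiffAt_abs h0).comp y h1

variable {τ : OpenPartialHomeomorph (EuclideanSpace ℝ (Fin n)) (EuclideanSpace ℝ (Fin n))}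

theorem OpenPartialHomeomorph.contDiffAt_of_mem_source (h : ContDiffOn ℝ ∞ τ τ.source)
    {y : EuclideanSpace ℝ (Fin n)} (hy : y ∈ τ.source) : ContDiffAt ℝ ∞ τ y :=
  h.contDiffAt (τ.open_source.mem_nhds hy)

theorem OpenPartialHomeomorph.fderiv_symm_comp_fderiv (h : ContDiffOn ℝ ∞ τ τ.source)
    (h' : ContDiffOn ℝ ∞ τ.symm τ.target) {y : EuclideanSpace ℝ (Fin n)} (hy : y ∈ τ.source) :
    (fderiv ℝ τ.symm (τ y)).comp (fderiv ℝ τ y) = ContinuousLinearMap.id ℝ _ := by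
  have h1 := (contDiffAt_of_mem_source h hy).differentiableAt (by simp)
  have h2 := (contDiffAt_of_mem_source (τ := τ.symm) h' (τ.map_source hy)).differentiableAt
    (by simp)
  rw [← fderiv_comp y h2 h1]
  have : τ.symm ∘ τ =ᶠ[𝓝 y] id := by
    filter_upwards [τ.open_source.mem_nhds hy] with z hz using τ.left_inv hz
  rw [this.fderiv_eq, fderiv_id]

theorem OpenPartialHomeomorph.det_fderiv_ne_zero (h : ContDiffOn ℝ ∞ τ τ.source)
    (h' : ContDiffOn ℝ ∞ τ.symm τ.target) {y : EuclideanSpace ℝ (Fin n)} (hy : y ∈ τ.source) :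
    (fderiv ℝ τ y).det ≠ 0 := by
  intro h0
  have h1 := congrArg ContinuousLinearMap.det (fderiv_symm_comp_fderiv h h' hy)
  have h2 : ((fderiv ℝ τ.symm (τ y)).comp (fderiv ℝ τ y)).det =
      (fderiv ℝ τ.symm (τ y)).det * (fderiv ℝ τ y).det := LinearMap.det_comp _ _
  rw [h2, h0, mul_zero] at h1
  have h3 : (ContinuousLinearMap.id ℝ (EuclideanSpace ℝ (Fin n))).det = 1 := LinearMap.det_id
  rw [h3] at h1
  exact zero_ne_one h1

theorem setIntegral_target_eq (h : ContDiffOn ℝ ∞ τ τ.source)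
    (f : EuclideanSpace ℝ (Fin n) → ℝ) :
    ∫ z in τ.target, f z = ∫ y in τ.source, |(fderiv ℝ τ y).det| * f (τ y) :=
  integral_target_eq_integral_abs_det_fderiv_smul volume (f := τ)
    (fun _ hy => ((τ.contDiffAt_of_mem_source h hy).differentiableAt (by simp)).hasFDerivAt) f

/-- On compact sets the change of variables gives integrability of the Jacobian times `f ∘ τ`; the
Jacobian is continuous and nonvanishing, so it can be divided out. -/
theorem LocallyIntegrableOn.comp_openPartialHomeomorph (h : ContDiffOn ℝ ∞ τ τ.source)
    (h' : ContDiffOn ℝ ∞ τ.symm τ.target) {f : EuclideanSpace ℝ (Fin n) → ℝ}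
    (hf : LocallyIntegrableOn f τ.target volume) :
    LocallyIntegrableOn (fun y => f (τ y)) τ.source volume := by
  rw [locallyIntegrableOn_iff τ.open_source.isLocallyClosed]
  intro K hK hKc
  have hi := hf.integrableOn_compact_subset (τ.image_source_eq_target ▸ image_mono hK)
    (hKc.image_of_continuousOn (τ.continuousOn.mono hK))
  rw [integrableOn_image_iff_integrableOn_abs_det_fderiv_smul volume hKc.measurableSet
    (fun y hy => ((τ.contDiffAt_of_mem_source h (hK hy)).differentiableAt
      (by simp)).hasFDerivAt.hasFDerivWithinAt) (τ.injOn.mono hK)] at hi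
  have hc : ContinuousOn (fun y => |(fderiv ℝ τ y).det|⁻¹) K := fun y hy =>
    (((τ.contDiffAt_of_mem_source h (hK hy)).abs_det_fderiv
      (τ.det_fderiv_ne_zero h h' (hK hy))).continuousAt.inv₀
        (abs_pos.2 (τ.det_fderiv_ne_zero h h' (hK hy))).ne').continuousWithinAt
  refine (hi.continuousOn_mul hc hKc).congr_fun (fun y hy => ?_) hKc.measurableSet
  simp only [smul_eq_mul]
  rw [inv_mul_cancel_left₀ (abs_pos.2 (τ.det_fderiv_ne_zero h h' (hK hy))).ne']

/-- The chain rule for weak derivatives under a smooth change of variables. -/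
theorem IsWeakPartial.comp_openPartialHomeomorph (h : ContDiffOn ℝ ∞ τ τ.source)
    (h' : ContDiffOn ℝ ∞ τ.symm τ.target) {u : EuclideanSpace ℝ (Fin n) → ℝ}
    {v : Fin n → EuclideanSpace ℝ (Fin n) → ℝ} (huv : ∀ k, IsWeakPartial τ.target k u (v k))
    (hu : LocallyIntegrableOn u τ.target volume) (i : Fin n) :
    IsWeakPartial τ.source i (fun y => u (τ y))
      (fun y => ∑ k, v k (τ y) * fderiv ℝ τ y (EuclideanSpace.single i 1) k) := by
  set e : EuclideanSpace ℝ (Fin n) := EuclideanSpace.single i 1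
  have hsrc : ∀ {y}, y ∈ τ.source → ContDiffAt ℝ ∞ τ y := τ.contDiffAt_of_mem_source h
  have htgt : ∀ {z}, z ∈ τ.target → ContDiffAt ℝ ∞ τ.symm z :=
    τ.symm.contDiffAt_of_mem_source h'
  have hdet : ∀ {z}, z ∈ τ.target → (fderiv ℝ τ.symm z).det ≠ 0 := fun hz =>
    τ.symm.det_fderiv_ne_zero h' (by simpa using h) hz
  have hcov : ∀ f : EuclideanSpace ℝ (Fin n) → ℝ,
      ∫ y in τ.source, f y = ∫ z in τ.target, |(fderiv ℝ τ.symm z).det| * f (τ.symm z) :=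
    setIntegral_target_eq (τ := τ.symm) h'
  refine ⟨LocallyIntegrableOn.comp_openPartialHomeomorph h h' hu, ?_, ?_⟩
  · rw [locallyIntegrableOn_iff τ.open_source.isLocallyClosed]
    intro K hK hKc
    refine integrable_finsetSum _ fun k _ => ?_
    refine ((LocallyIntegrableOn.comp_openPartialHomeomorph h h'
      (huv k).2.1).integrableOn_compact_subset hK hKc).mul_continuousOn (fun y hy => ?_) hKc
    exact ((hsrc (hK hy)).fderiv_apply_apply e k).continuousAt.continuousWithinAt
  intro ψ hψ hψc hψs
  set Jac : EuclideanSpace ℝ (Fin n) → ℝ := fun z => |(fderiv ℝ τ.symm z).det|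
  set S : Set (EuclideanSpace ℝ (Fin n)) := τ '' tsupport ψ
  have hSc : IsCompact S := IsCompact.image_of_continuousOn hψc (τ.continuousOn.mono hψs)
  have hSt : S ⊆ τ.target := τ.image_source_eq_target ▸ image_mono hψs
  have hSψ : ∀ {z}, z ∈ τ.target → z ∉ S → τ.symm z ∉ tsupport ψ := fun hz hzS hz' =>
    hzS ⟨_, hz', τ.right_inv hz⟩
  -- The Piola transform of the vector field `ψ eᵢ`: its components serve as test functions for the
  -- derivatives `v k` on the target.
  set θ : Fin n → EuclideanSpace ℝ (Fin n) → ℝ := fun k => τ.target.indicator fun z =>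
    Jac z * (fderiv ℝ τ (τ.symm z) e k * ψ (τ.symm z)) with hθdef
  have hθS : ∀ k, tsupport (θ k) ⊆ S := by
    intro k
    refine closure_minimal (fun z hz => ?_) hSc.isClosed
    by_contra hzS
    apply hz
    by_cases hzt : z ∈ τ.target
    · simp only [hθdef, indicator_of_mem hzt]
      rw [image_eq_zero_of_notMem_tsupport (hSψ hzt hzS)]
      simp
    · simp only [hθdef, indicator_of_notMem hzt]
  have hθc : ∀ k, HasCompactSupport (θ k) := fun k =>
    hSc.of_isClosed_subset (isClosed_tsupport _) (hθS k)
  have hθ : ∀ k, ContDiff ℝ ∞ (θ k) := by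
    refine fun k => contDiff_of_contDiffAt_tsupport fun z hz => ?_
    have hzt := hSt (hθS k hz)
    have h1 : ContDiffAt ℝ ∞ (fun z => Jac z * (fderiv ℝ τ (τ.symm z) e k * ψ (τ.symm z))) z := by
      refine ((htgt hzt).abs_det_fderiv (hdet hzt)).mul (ContDiffAt.mul ?_ ?_)
      · exact ContDiffAt.comp z ((hsrc (τ.map_target hzt)).fderiv_apply_apply e k) (htgt hzt)
      · exact hψ.contDiffAt.comp z (htgt hzt)
    refine h1.congr_of_eventuallyEq ?_
    filter_upwards [τ.open_target.mem_nhds hzt] with y hy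
    exact indicator_of_mem hy _
  -- Piola's identity: the divergence of `θ` is the Jacobian times `∂ᵢψ ∘ τ⁻¹`. It is checked
  -- against an arbitrary test function `w`, by integrating by parts on both sides and changing
  -- variables in between, so the Jacobian never has to be differentiated explicitly.
  have hpiola : ∀ᵐ z, z ∈ τ.target →
      ((fun z => ∑ k, fderiv ℝ (θ k) z (EuclideanSpace.single k 1)) -
        fun z => Jac z * fderiv ℝ ψ (τ.symm z) e) z = 0 := by
    refine τ.open_target.ae_eq_zero_of_integral_contDiff_smul_eq_zero ?_ fun w hw hwc hws => ?_
    · refine ContinuousOn.locallyIntegrableOn (fun z hz => ?_) τ.open_target.measurableSet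
      refine ContinuousAt.continuousWithinAt (ContinuousAt.sub ?_ (ContinuousAt.mul ?_ ?_))
      · exact Continuous.continuousAt (continuous_finsetSum _ fun k _ =>
          ((hθ k).continuous_fderiv (by simp)).clm_apply continuous_const)
      · exact ((htgt hz).abs_det_fderiv (hdet hz)).continuousAt
      · exact ContinuousAt.comp (f := τ.symm) (g := fun y => fderiv ℝ ψ y e)
          ((hψ.continuous_fderiv (by simp)).clm_apply continuous_const).continuousAt
          (htgt hz).continuousAt
    · have hwi : ∀ {f : EuclideanSpace ℝ (Fin n) → ℝ}, ContinuousOn f τ.target →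
          Integrable (fun z => w z * f z) := by
        intro f hf
        rw [← integrableOn_iff_integrable_of_support_subset (s := tsupport w) fun z hz => ?_]
        · exact ContinuousOn.integrableOn_compact hwc
            (hw.continuous.continuousOn.mul (hf.mono hws))
        · by_contra hzw
          exact hz (by simp [image_eq_zero_of_notMem_tsupport hzw])
      have hc1 : ∀ k, Continuous fun z => fderiv ℝ (θ k) z (EuclideanSpace.single k 1) := fun k =>
        ((hθ k).continuous_fderiv (by simp)).clm_apply continuous_const
      have hc2 : ContinuousOn (fun z => Jac z * fderiv ℝ ψ (τ.symm z) e) τ.target := by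
        intro z hz
        refine ContinuousAt.continuousWithinAt (ContinuousAt.mul ?_ ?_)
        · exact ((htgt hz).abs_det_fderiv (hdet hz)).continuousAt
        · exact ContinuousAt.comp (f := τ.symm) (g := fun y => fderiv ℝ ψ y e)
            ((hψ.continuous_fderiv (by simp)).clm_apply continuous_const).continuousAt
            (htgt hz).continuousAt
      have e1 : ∫ z, w z * ∑ k, fderiv ℝ (θ k) z (EuclideanSpace.single k 1) =
          - ∫ z, ∑ k, fderiv ℝ w z (EuclideanSpace.single k 1) * θ k z := by
        have i1 : ∀ k, Integrable fun z => fderiv ℝ w z (EuclideanSpace.single k 1) * θ k z :=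
          fun k => Continuous.integrable_of_hasCompactSupport
            (((hw.continuous_fderiv (by simp)).clm_apply continuous_const).mul
              (hθ k).continuous) (hθc k).mul_left
        simp only [Finset.mul_sum]
        rw [integral_finsetSum _ fun k _ => hwi (hc1 k).continuousOn,
          integral_finsetSum _ fun k _ => i1 k, ← Finset.sum_neg_distrib]
        exact Finset.sum_congr rfl fun k _ => integral_mul_fderiv_eq_neg_of_tsupport_subset
          (fun x _ => hw.contDiffAt) (hθ k) (hθc k) _
      have hwτ : ∀ y ∈ tsupport ψ, ContDiffAt ℝ ∞ (fun y => w (τ y)) y := fun y hy =>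
        hw.contDiffAt.comp y (hsrc (hψs hy))
      have e2 : ∫ z, ∑ k, fderiv ℝ w z (EuclideanSpace.single k 1) * θ k z =
          ∫ y, fderiv ℝ (fun y => w (τ y)) y e * ψ y := by
        rw [← setIntegral_mul_eq_integral_of_tsupport_subset hψs, hcov,
          ← setIntegral_eq_integral_of_forall_compl_eq_zero (s := τ.target)]
        · refine setIntegral_congr_fun τ.open_target.measurableSet fun z hz => ?_
          have hd : fderiv ℝ (fun y => w (τ y)) (τ.symm z) =
              (fderiv ℝ w (τ (τ.symm z))).comp (fderiv ℝ τ (τ.symm z)) :=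
            fderiv_comp _ (hw.differentiable (by simp) _)
              ((hsrc (τ.map_target hz)).differentiableAt (by simp))
          simp only [hθdef, indicator_of_mem hz, hd, ContinuousLinearMap.comp_apply,
            τ.right_inv hz]
          rw [clm_apply_eq_sum (fderiv ℝ w z), Finset.sum_mul, Finset.mul_sum]
          refine Finset.sum_congr rfl fun k _ => ?_
          ring
        · intro z hz
          simp [hθdef, indicator_of_notMem hz]
      have e3 := integral_mul_fderiv_eq_neg_of_tsupport_subset hwτ hψ hψc e
      have e4 : ∫ y, w (τ y) * fderiv ℝ ψ y e = ∫ z, w z * (Jac z * fderiv ℝ ψ (τ.symm z) e) := by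
        rw [← setIntegral_mul_fderiv_eq_integral_of_tsupport_subset hψs, hcov,
          ← setIntegral_eq_integral_of_forall_compl_eq_zero (s := τ.target)
            (f := fun z => w z * (Jac z * fderiv ℝ ψ (τ.symm z) e))]
        · refine setIntegral_congr_fun τ.open_target.measurableSet fun z hz => ?_
          simp only [τ.right_inv hz, Jac]
          ring
        · intro z hz
          rw [image_eq_zero_of_notMem_tsupport fun hh => hz (hws hh), zero_mul]
      simp only [Pi.sub_apply, smul_eq_mul, mul_sub]
      rw [integral_sub (hwi (continuous_finsetSum _ fun k _ => hc1 k).continuousOn) (hwi hc2),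
        e1, e2, ← e3, e4, sub_self]
  have hL : ∫ y in τ.source, u (τ y) * fderiv ℝ ψ y e =
      ∫ z in τ.target, ∑ k, u z * fderiv ℝ (θ k) z (EuclideanSpace.single k 1) := by
    rw [hcov]
    refine integral_congr_ae ?_
    rw [EventuallyEq, ae_restrict_iff' τ.open_target.measurableSet]
    filter_upwards [hpiola] with z hz hzt
    have := sub_eq_zero.1 (hz hzt)
    dsimp only at this ⊢
    rw [← Finset.mul_sum, this, τ.right_inv hzt]
    ring
  have hR : ∫ y in τ.source, (∑ k, v k (τ y) * fderiv ℝ τ y e k) * ψ y =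
      ∫ z in τ.target, ∑ k, v k z * θ k z := by
    rw [hcov]
    refine setIntegral_congr_fun τ.open_target.measurableSet fun z hz => ?_
    simp only [hθdef, indicator_of_mem hz, τ.right_inv hz]
    rw [Finset.sum_mul, Finset.mul_sum]
    refine Finset.sum_congr rfl fun k _ => ?_
    ring
  rw [hL, hR, integral_finsetSum, integral_finsetSum, ← Finset.sum_neg_distrib]
  · exact Finset.sum_congr rfl fun k _ => (huv k).2.2 (θ k) (hθ k) (hθc k) ((hθS k).trans hSt)
  · exact fun k _ => ((huv k).2.1.integrable_mul_of_tsupport_subset (hθ k).continuous (hθc k)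
      ((hθS k).trans hSt)).integrableOn
  · intro k _
    have hsub : tsupport (fun z => fderiv ℝ (θ k) z (EuclideanSpace.single k 1)) ⊆ tsupport (θ k) :=
      tsupport_fderiv_apply_subset ℝ _
    exact (hu.integrable_mul_of_tsupport_subset (((hθ k).continuous_fderiv
      (by simp)).clm_apply continuous_const) ((hθc k).fderiv_apply (𝕜 := ℝ) _)
      (hsub.trans ((hθS k).trans hSt))).integrableOn

end ChangeOfVariables

/-! ### Metric components in charts and their transformation -/

section Geometry

open Filter
open scoped Topology

variable {n : ℕ} {M : Type*} [TopologicalSpace M] [ChartedSpace (EuclideanSpace ℝ (Fin n)) M]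
  [IsManifold (𝓡 n) ∞ M]
  {e e' : OpenPartialHomeomorph M (EuclideanSpace ℝ (Fin n))}

theorem contDiffOn_transition (he : e ∈ atlas (EuclideanSpace ℝ (Fin n)) M)
    (he' : e' ∈ atlas (EuclideanSpace ℝ (Fin n)) M) :
    ContDiffOn ℝ ∞ (e.symm.trans e') (e.symm.trans e').source := by
  rw [← contMDiffOn_iff_contDiffOn]
  exact contMDiffOn_of_mem_contDiffGroupoid
    ((contDiffGroupoid ∞ (𝓡 n)).compatible he he')

theorem contDiffOn_transition_symm (he : e ∈ atlas (EuclideanSpace ℝ (Fin n)) M)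
    (he' : e' ∈ atlas (EuclideanSpace ℝ (Fin n)) M) :
    ContDiffOn ℝ ∞ (e.symm.trans e').symm (e.symm.trans e').target := by
  have h := contDiffOn_transition he' he
  rw [OpenPartialHomeomorph.trans_symm_eq_symm_trans_symm, e.symm_symm]
  convert h using 1
  rw [← OpenPartialHomeomorph.symm_source, OpenPartialHomeomorph.trans_symm_eq_symm_trans_symm,
    e.symm_symm]

theorem contDiffOn_comp_symm {f : M → ℝ} (hf : ContMDiff (𝓡 n) 𝓘(ℝ) ∞ f)
    (he : e ∈ atlas (EuclideanSpace ℝ (Fin n)) M) :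
    ContDiffOn ℝ ∞ (fun y => f (e.symm y)) e.target := by
  rw [← contMDiffOn_iff_contDiffOn]
  exact hf.comp_contMDiffOn (contMDiffOn_symm_of_mem_maximalAtlas
    (IsManifold.subset_maximalAtlas he))

theorem bilinear_apply_eq_sum {V : Type*} [AddCommGroup V] [Module ℝ V] [TopologicalSpace V]
    [IsTopologicalAddGroup V] [ContinuousSMul ℝ V]
    (B : V →L[ℝ] V →L[ℝ] ℝ) (L : EuclideanSpace ℝ (Fin n) →L[ℝ] V)
    (v w : EuclideanSpace ℝ (Fin n)) :
    B (L v) (L w) = ∑ i, ∑ j, v i * w j *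
      B (L (EuclideanSpace.single i 1)) (L (EuclideanSpace.single j 1)) := by
  have hx : ∀ x : EuclideanSpace ℝ (Fin n), x = ∑ i, x i • EuclideanSpace.single i (1 : ℝ) := by
    intro x
    ext j
    simp [Finset.sum_apply, Pi.single_apply]
  conv_lhs => rw [hx v, hx w]
  simp only [map_sum, map_smul, _root_.sum_apply, _root_.smul_apply, smul_eq_mul, Finset.mul_sum]
  rw [Finset.sum_comm]
  exact Finset.sum_congr rfl fun i _ => Finset.sum_congr rfl fun j _ => by ring

variable (γ : ContinuousRiemannianMetric (EuclideanSpace ℝ (Fin n))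
  (fun x : M => TangentSpace (𝓡 n) x))

theorem isSymm_metricComponents (e : OpenPartialHomeomorph M (EuclideanSpace ℝ (Fin n)))
    (y : EuclideanSpace ℝ (Fin n)) : (metricComponents γ e y).IsSymm :=
  Matrix.IsSymm.ext fun _ _ => γ.symm _ _ _

/-- The derivative of the inverse chart is injective, so the components form the Gram matrix of
linearly independent vectors. -/
theorem det_metricComponents_pos (he : e ∈ atlas (EuclideanSpace ℝ (Fin n)) M)
    {y : EuclideanSpace ℝ (Fin n)} (hy : y ∈ e.target) : 0 < (metricComponents γ e y).det := by
  have hmd : e.MDifferentiable (𝓡 n) (𝓡 n) := mdifferentiable_of_mem_atlas he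
  have hinj : Function.Injective (mfderiv (𝓡 n) (𝓡 n) e.symm y) := hmd.symm.mfderiv_injective hy
  refine (Matrix.PosDef.of_dotProduct_mulVec_pos ?_ fun x hx => ?_).det_pos
  · have := isSymm_metricComponents γ e y
    rw [Matrix.IsHermitian, Matrix.conjTranspose_eq_transpose_of_trivial]
    exact this
  · have hb : γ.inner (e.symm y) (mfderiv (𝓡 n) (𝓡 n) e.symm y (WithLp.toLp 2 x))
        (mfderiv (𝓡 n) (𝓡 n) e.symm y (WithLp.toLp 2 x)) =
        ∑ i, ∑ j, x i * x j * metricComponents γ e y i j :=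
      bilinear_apply_eq_sum (γ.inner (e.symm y)) (mfderiv (𝓡 n) (𝓡 n) e.symm y)
        (WithLp.toLp 2 x) (WithLp.toLp 2 x)
    have hpos : 0 < γ.inner (e.symm y) (mfderiv (𝓡 n) (𝓡 n) e.symm y (WithLp.toLp 2 x))
        (mfderiv (𝓡 n) (𝓡 n) e.symm y (WithLp.toLp 2 x)) := by
      refine γ.pos _ _ fun h0 => hx ?_
      have h1 := hinj (h0.trans (map_zero _).symm)
      exact congrArg WithLp.ofLp h1
    refine lt_of_lt_of_eq hpos (Eq.trans hb ?_)
    simp only [dotProduct, Matrix.mulVec, star_trivial, Finset.mul_sum]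
    refine Finset.sum_congr rfl fun i _ => Finset.sum_congr rfl fun j _ => ?_
    ring

/-- The tangent map of the inverse chart is continuous, so coordinate vector fields are continuous
sections, and `γ` is evaluated on them in the bundle. -/
theorem continuousOn_metricComponents (he : e ∈ atlas (EuclideanSpace ℝ (Fin n)) M)
    (i j : Fin n) : ContinuousOn (fun y => metricComponents γ e y i j) e.target := by
  have hsm : ContMDiffOn (𝓡 n) (𝓡 n) ∞ e.symm e.target :=
    contMDiffOn_symm_of_mem_maximalAtlas (IsManifold.subset_maximalAtlas he)
  have hT := hsm.continuousOn_tangentMapWithin (by simp) e.open_target.uniqueMDiffOn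
  have hvec : ∀ k : Fin n, ContinuousOn (fun y => (TotalSpace.mk' (EuclideanSpace ℝ (Fin n))
      (E := fun x : M => TangentSpace (𝓡 n) x) (e.symm y)
      (mfderiv (𝓡 n) (𝓡 n) e.symm y
        (EuclideanSpace.single k (1 : ℝ) : EuclideanSpace ℝ (Fin n))))) e.target := by
    intro k
    have hc : Continuous fun y : EuclideanSpace ℝ (Fin n) =>
        (tangentBundleModelSpaceHomeomorph (𝓡 n)).symm (y, EuclideanSpace.single k (1 : ℝ)) :=
      (tangentBundleModelSpaceHomeomorph (𝓡 n)).symm.continuous.comp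
        (continuous_id.prodMk continuous_const)
    refine (hT.comp (t := π (EuclideanSpace ℝ (Fin n)) (TangentSpace (𝓡 n)) ⁻¹' e.target)
      hc.continuousOn fun y hy => hy).congr fun y hy => ?_
    simp only [Function.comp, tangentMapWithin]
    have : mfderivWithin (𝓡 n) (𝓡 n) e.symm e.target y = mfderiv (𝓡 n) (𝓡 n) e.symm y :=
      mfderivWithin_of_isOpen e.open_target hy
    change _ = TotalSpace.mk' _ (e.symm y) (mfderivWithin (𝓡 n) (𝓡 n) e.symm e.target y _)
    rw [this]
    rfl
  have hγ : ContinuousOn (fun y => TotalSpace.mk' (EuclideanSpace ℝ (Fin n) →L[ℝ]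
      EuclideanSpace ℝ (Fin n) →L[ℝ] ℝ)
      (E := fun x : M => TangentSpace (𝓡 n) x →L[ℝ] TangentSpace (𝓡 n) x →L[ℝ] ℝ)
      (e.symm y) (γ.inner (e.symm y))) e.target :=
    γ.continuous.comp_continuousOn e.continuousOn_symm
  have := ContinuousOn.clm_bundle_apply₂ (F₁ := EuclideanSpace ℝ (Fin n))
    (F₂ := EuclideanSpace ℝ (Fin n)) (F₃ := ℝ) (E₃ := Bundle.Trivial M ℝ) hγ (hvec i) (hvec j)
  intro y hy
  have h2 := this y hy
  simp only [FiberBundle.continuousWithinAt_totalSpace] at h2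
  exact h2.2

/-- Near `y` the inverse chart of `e` is that of `e'` composed with the transition map; the chain
rule and bilinearity give the congruence. -/
theorem metricComponents_transition (he : e ∈ atlas (EuclideanSpace ℝ (Fin n)) M)
    (he' : e' ∈ atlas (EuclideanSpace ℝ (Fin n)) M) {y : EuclideanSpace ℝ (Fin n)}
    (hy : y ∈ (e.symm.trans e').source) :
    metricComponents γ e y = (jacobianMatrix (fderiv ℝ (e.symm.trans e') y)).transpose *
      metricComponents γ e' ((e.symm.trans e') y) *
      jacobianMatrix (fderiv ℝ (e.symm.trans e') y) := by
  set τ := e.symm.trans e' with hτ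
  have hy' : e.symm y ∈ e'.source := by
    rw [hτ, OpenPartialHomeomorph.trans_source] at hy
    exact hy.2
  have hyt : τ y ∈ e'.target := e'.map_source hy'
  have hx : e'.symm (τ y) = e.symm y := e'.left_inv hy'
  have hmd : MDifferentiableAt (𝓡 n) (𝓡 n) e'.symm (τ y) :=
    mdifferentiableAt_atlas_symm he' hyt
  have hτd : DifferentiableAt ℝ τ y :=
    (τ.contDiffAt_of_mem_source (contDiffOn_transition he he') hy).differentiableAt (by simp)
  have hev : e.symm =ᶠ[𝓝 y] e'.symm ∘ τ := by
    filter_upwards [τ.open_source.mem_nhds hy] with z hz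
    rw [hτ, OpenPartialHomeomorph.trans_source] at hz
    exact (e'.left_inv hz.2).symm
  have hcomp : mfderiv (𝓡 n) (𝓡 n) (e'.symm ∘ τ) y =
      (mfderiv (𝓡 n) (𝓡 n) e'.symm (τ y)).comp (mfderiv (𝓡 n) (𝓡 n) τ y) :=
    mfderiv_comp y hmd hτd.mdifferentiableAt
  have hD : ∀ v : EuclideanSpace ℝ (Fin n),
      (mfderiv (𝓡 n) (𝓡 n) e.symm y v : EuclideanSpace ℝ (Fin n)) =
      (mfderiv (𝓡 n) (𝓡 n) e'.symm (τ y) (fderiv ℝ τ y v) : EuclideanSpace ℝ (Fin n)) := by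
    intro v
    have h1 : mfderiv (𝓡 n) (𝓡 n) e.symm y = mfderiv (𝓡 n) (𝓡 n) (e'.symm ∘ τ) y :=
      hev.mfderiv_eq
    have h2 : mfderiv (𝓡 n) (𝓡 n) τ y = fderiv ℝ τ y := mfderiv_eq_fderiv
    rw [hcomp, h2] at h1
    exact congrArg (fun L : EuclideanSpace ℝ (Fin n) →L[ℝ] EuclideanSpace ℝ (Fin n) => L v) h1
  -- All tangent spaces share one model space; on it the form can be rewritten along the equality of
  -- base points `hx`.
  let Q : M → EuclideanSpace ℝ (Fin n) → EuclideanSpace ℝ (Fin n) → ℝ :=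
    fun x v w => γ.inner x v w
  ext i j
  have h1 : metricComponents γ e y i j = Q (e.symm y)
      (mfderiv (𝓡 n) (𝓡 n) e.symm y (EuclideanSpace.single i (1 : ℝ) : EuclideanSpace ℝ (Fin n)))
      (mfderiv (𝓡 n) (𝓡 n) e.symm y (EuclideanSpace.single j (1 : ℝ) : EuclideanSpace ℝ (Fin n))) :=
    rfl
  rw [h1, hD, hD, ← hx]
  refine Eq.trans (b := ∑ a, ∑ b, fderiv ℝ τ y (EuclideanSpace.single i 1) a *
    fderiv ℝ τ y (EuclideanSpace.single j 1) b * metricComponents γ e' (τ y) a b)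
    (bilinear_apply_eq_sum (γ.inner (e'.symm (τ y))) (mfderiv (𝓡 n) (𝓡 n) e'.symm (τ y))
      (fderiv ℝ τ y (EuclideanSpace.single i 1)) (fderiv ℝ τ y (EuclideanSpace.single j 1))) ?_
  simp only [Matrix.mul_apply, Finset.sum_mul, Matrix.transpose_apply]
  rw [Finset.sum_comm]
  refine Finset.sum_congr rfl fun b _ => Finset.sum_congr rfl fun a _ => ?_
  simp only [Matrix.of_apply, jacobianMatrix]
  ring

end Geometry

/-! ### Gradient pairing and the integral of the Laplacian -/

section GradientPairing

open Filter
open scoped Topology Matrix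

theorem Matrix.mul_inv_transpose_mul_mul {m : Type*} [Fintype m] [DecidableEq m]
    {J A : Matrix m m ℝ} (hJ : J.det ≠ 0) :
    J * (J.transpose * A * J)⁻¹ * J.transpose = A⁻¹ := by
  have hJ' : IsUnit J.det := isUnit_iff_ne_zero.2 hJ
  have hJt : IsUnit J.transpose.det := by rwa [Matrix.det_transpose]
  rw [Matrix.mul_inv_rev, Matrix.mul_inv_rev, Matrix.mul_nonsing_inv_cancel_left _ _ hJ',
    Matrix.nonsing_inv_mul_cancel_right _ _ hJt]

theorem IsWeakPartial.congr_left {n : ℕ} {Ω : Set (EuclideanSpace ℝ (Fin n))} {i : Fin n}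
    {u u' v : EuclideanSpace ℝ (Fin n) → ℝ} (h : IsWeakPartial Ω i u v) (hΩ : IsOpen Ω)
    (huu : EqOn u u' Ω) : IsWeakPartial Ω i u' v := by
  refine ⟨?_, h.2.1, fun ψ h1 h2 h3 => ?_⟩
  · rw [locallyIntegrableOn_iff hΩ.isLocallyClosed]
    intro K hK hKc
    exact (h.1.integrableOn_compact_subset hK hKc).congr_fun (huu.mono hK) hKc.measurableSet
  · rw [← h.2.2 ψ h1 h2 h3]
    refine setIntegral_congr_fun hΩ.measurableSet fun y hy => ?_
    simp only [huu hy]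

variable {n : ℕ} {M : Type*} [TopologicalSpace M] [ChartedSpace (EuclideanSpace ℝ (Fin n)) M]
  [IsManifold (𝓡 n) ∞ M]
  {e e' : OpenPartialHomeomorph M (EuclideanSpace ℝ (Fin n))}
  (γ : ContinuousRiemannianMetric (EuclideanSpace ℝ (Fin n))
    (fun x : M => TangentSpace (𝓡 n) x))

/-- The density `√|γ| γⁱʲ ∂ᵢχ ∂ⱼφ` in the chart `e`, with weak derivatives of `φ`. -/
def gradPairing (e : OpenPartialHomeomorph M (EuclideanSpace ℝ (Fin n))) (χ φ : M → ℝ)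
    (y : EuclideanSpace ℝ (Fin n)) : ℝ :=
  √(metricComponents γ e y).det *
    ((fun i => fderiv ℝ (fun z => χ (e.symm z)) y (EuclideanSpace.single i 1)) ⬝ᵥ
      ((metricComponents γ e y)⁻¹ *ᵥ
        fun j => weakPartial e.target j (fun z => φ (e.symm z)) y))

theorem gradPairing_eq_sum (χ φ : M → ℝ) (y : EuclideanSpace ℝ (Fin n)) :
    gradPairing γ e χ φ y = ∑ i, ∑ j, √(metricComponents γ e y).det *
      (metricComponents γ e y)⁻¹ i j *
      (fderiv ℝ (fun z => χ (e.symm z)) y (EuclideanSpace.single i 1) *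
        weakPartial e.target j (fun z => φ (e.symm z)) y) := by
  simp only [gradPairing, dotProduct, Matrix.mulVec, Finset.mul_sum]
  exact Finset.sum_congr rfl fun i _ => Finset.sum_congr rfl fun j _ => by ring

theorem gradPairing_eq_zero {χ φ : M → ℝ} {y : EuclideanSpace ℝ (Fin n)} (hy : y ∈ e.target)
    (hχ : e.symm y ∉ tsupport χ) : gradPairing γ e χ φ y = 0 := by
  have h1 : ∀ᶠ z in 𝓝 y, χ (e.symm z) = 0 :=
    (e.continuousAt_symm hy).eventually (notMem_tsupport_iff_eventuallyEq.1 hχ)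
  have h2 : (fun z => χ (e.symm z)) =ᶠ[𝓝 y] fun _ => 0 := h1
  rw [gradPairing_eq_sum, h2.fderiv_eq]
  simp

/-- The pairing of gradients transforms as a density under a change of charts. -/
theorem ae_gradPairing_transition (he : e ∈ atlas (EuclideanSpace ℝ (Fin n)) M)
    (he' : e' ∈ atlas (EuclideanSpace ℝ (Fin n)) M) {χ φ : M → ℝ}
    (hχ : ContMDiff (𝓡 n) 𝓘(ℝ) ∞ χ)
    (hφ : ∀ e ∈ atlas (EuclideanSpace ℝ (Fin n)) M, ∀ i,
      ∃ v, IsWeakPartial e.target i (fun y => φ (e.symm y)) v)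
    (hφl : LocallyIntegrableOn (fun y => φ (e'.symm y)) e'.target volume) :
    ∀ᵐ y ∂(volume.restrict (e.symm.trans e').source),
      gradPairing γ e χ φ y = |(fderiv ℝ (e.symm.trans e') y).det| *
        gradPairing γ e' χ φ ((e.symm.trans e') y) := by
  have hc := contDiffOn_transition he he'
  have hc' := contDiffOn_transition_symm he he'
  set τ := e.symm.trans e' with hτ
  have hsrc : τ.source = e.target ∩ e.symm ⁻¹' e'.source := by
    rw [hτ, OpenPartialHomeomorph.trans_source]
    rfl
  have hτe : ∀ y ∈ τ.source, τ y ∈ e'.target ∧ e'.symm (τ y) = e.symm y := by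
    intro y hy
    rw [hsrc] at hy
    exact ⟨e'.map_source hy.2, e'.left_inv hy.2⟩
  have htgt : τ.target ⊆ e'.target := by
    intro z hz
    have := (hτe _ (τ.map_target hz)).1
    rwa [τ.right_inv hz] at this
  -- Chain rule for the chosen representatives: both sides are weak derivatives of the same function
  -- on the overlap, so uniqueness applies.
  have hweak : ∀ᵐ y ∂(volume.restrict τ.source), ∀ j,
      weakPartial e.target j (fun z => φ (e.symm z)) y =
      ∑ k, weakPartial e'.target k (fun z => φ (e'.symm z)) (τ y) *
        fderiv ℝ τ y (EuclideanSpace.single j 1) k := by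
    rw [ae_all_iff]
    intro j
    have h1 := (isWeakPartial_weakPartial (hφ e he j)).mono (Ω' := τ.source)
      (hsrc ▸ inter_subset_left)
    have h2 := IsWeakPartial.comp_openPartialHomeomorph hc hc'
      (fun k => (isWeakPartial_weakPartial (hφ e' he' k)).mono htgt) (hφl.mono_set htgt) j
    refine h1.ae_eq τ.open_source (h2.congr_left τ.open_source fun y hy => ?_)
    simp only [(hτe y hy).2]
  filter_upwards [hweak, ae_restrict_mem τ.open_source.measurableSet] with y hwy hy
  set J := jacobianMatrix (fderiv ℝ τ y) with hJdef
  have hJ : J.det ≠ 0 := by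
    rw [hJdef, det_jacobianMatrix]
    exact τ.det_fderiv_ne_zero hc hc' hy
  have hτd : DifferentiableAt ℝ τ y := (τ.contDiffAt_of_mem_source hc hy).differentiableAt (by simp)
  have hχd : DifferentiableAt ℝ (fun z => χ (e'.symm z)) (τ y) :=
    ((contDiffOn_comp_symm hχ he').contDiffAt
      (e'.open_target.mem_nhds (hτe y hy).1)).differentiableAt (by simp)
  have hb : (fun j => weakPartial e.target j (fun z => φ (e.symm z)) y) =
      Jᵀ *ᵥ fun k => weakPartial e'.target k (fun z => φ (e'.symm z)) (τ y) := by
    ext j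
    rw [hwy j]
    simp only [Matrix.mulVec, dotProduct, Matrix.transpose_apply]
    exact Finset.sum_congr rfl fun k _ => mul_comm _ _
  have ha : (fun i => fderiv ℝ (fun z => χ (e.symm z)) y (EuclideanSpace.single i 1)) =
      Jᵀ *ᵥ fun k => fderiv ℝ (fun z => χ (e'.symm z)) (τ y) (EuclideanSpace.single k 1) := by
    ext i
    have hev : (fun z => χ (e.symm z)) =ᶠ[𝓝 y] (fun z => χ (e'.symm z)) ∘ τ := by
      filter_upwards [τ.open_source.mem_nhds hy] with z hz
      simp only [Function.comp, (hτe z hz).2]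
    rw [hev.fderiv_eq, fderiv_comp y hχd hτd, ContinuousLinearMap.comp_apply, clm_apply_eq_sum]
    rfl
  have hg := metricComponents_transition γ he he' hy
  rw [← hJdef] at hg
  rw [gradPairing, gradPairing, ha, hb, hg, Matrix.det_mul, Matrix.det_mul, Matrix.det_transpose]
  -- The volume density supplies the Jacobian factor; the covector pairing itself is invariant.
  have hsq : √(J.det * (metricComponents γ e' (τ y)).det * J.det) =
      |(fderiv ℝ τ y).det| * √(metricComponents γ e' (τ y)).det := by
    rw [mul_right_comm, ← pow_two, Real.sqrt_mul (sq_nonneg _), Real.sqrt_sq_eq_abs, hJdef,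
      det_jacobianMatrix]
  rw [hsq, mul_assoc]
  congr 2
  rw [Matrix.mulVec_transpose, ← Matrix.dotProduct_mulVec, Matrix.mulVec_mulVec,
    Matrix.mulVec_mulVec, Matrix.mul_inv_transpose_mul_mul hJ]

variable {p : ℝ} {φ : M → ℝ}

theorem continuousOn_inv_metricComponents (he : e ∈ atlas (EuclideanSpace ℝ (Fin n)) M)
    (i j : Fin n) : ContinuousOn (fun y => √(metricComponents γ e y).det *
      (metricComponents γ e y)⁻¹ i j) e.target := by
  intro y hy
  have hg : ContinuousWithinAt (metricComponents γ e) e.target y :=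
    tendsto_pi_nhds.2 fun a => tendsto_pi_nhds.2 fun b => continuousOn_metricComponents γ he a b y hy
  have hdet := (det_metricComponents_pos γ he hy).ne'
  exact ((continuousAt_sqrt_det (A := metricComponents γ e y)).mul
    (continuousAt_inv_apply hdet i j)).comp_continuousWithinAt hg

/-- The integrand vanishes off the image of `C`; on that compact set it is a sum of continuous
coefficients times locally integrable weak derivatives. The alternative in `hz` lets either `η` or
`χ` provide the compact support. -/
theorem integrableOn_mul_gradPairing (he : e ∈ atlas (EuclideanSpace ℝ (Fin n)) M)
    {η χ : M → ℝ} (hη : Continuous η) (hχ : ContMDiff (𝓡 n) 𝓘(ℝ) ∞ χ)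
    (hφ : ManifoldMemW2 n p φ) {C : Set M} (hC : IsCompact C) (hCe : C ⊆ e.source)
    (hz : ∀ x ∉ C, η x = 0 ∨ x ∉ tsupport χ) :
    IntegrableOn (fun y => η (e.symm y) * gradPairing γ e χ φ y) e.target := by
  have hK : IsCompact (e '' C) := hC.image_of_continuousOn (e.continuousOn.mono hCe)
  have hKt : e '' C ⊆ e.target := by
    rintro _ ⟨x, hx, rfl⟩
    exact e.map_source (hCe hx)
  refine IntegrableOn.of_forall_sdiff_eq_zero (s := e '' C) ?_ e.open_target.measurableSet
    fun y hy => ?_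
  · have hηc : ContinuousOn (fun y => η (e.symm y)) (e '' C) :=
      (hη.comp_continuousOn e.continuousOn_symm).mono hKt
    refine IntegrableOn.continuousOn_mul hηc ?_ hK
    have hsum : gradPairing γ e χ φ = _ := funext fun y => gradPairing_eq_sum γ χ φ y
    rw [hsum]
    refine integrable_finsetSum _ fun i _ => integrable_finsetSum _ fun j _ => ?_
    refine IntegrableOn.continuousOn_mul
      ((continuousOn_inv_metricComponents γ he i j).mono hKt) ?_ hK
    refine IntegrableOn.continuousOn_mul (fun y hy => ?_)
      ((isWeakPartial_weakPartial ((hφ e he).exists_first j)).2.1.integrableOn_compact_subset hKt hK)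
      hK
    have := ((contDiffOn_comp_symm hχ he).contDiffAt
      (e.open_target.mem_nhds (hKt hy))).fderiv_right (m := 0) (by simp)
    exact (this.continuousAt.clm_apply continuousAt_const).continuousWithinAt
  · have hyC : e.symm y ∉ C := fun h => hy.2 ⟨_, h, e.right_inv hy.1⟩
    rcases hz _ hyC with h | h
    · rw [h, zero_mul]
    · rw [gradPairing_eq_zero γ hy.1 h, mul_zero]

/-- The two supports confine both integrals to the overlap of the charts, where the density factor
of the pairing is exactly that of the change of variables. -/
theorem setIntegral_mul_gradPairing_transition (he : e ∈ atlas (EuclideanSpace ℝ (Fin n)) M)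
    (he' : e' ∈ atlas (EuclideanSpace ℝ (Fin n)) M) {η χ : M → ℝ}
    (hχ : ContMDiff (𝓡 n) 𝓘(ℝ) ∞ χ) (hφ : ManifoldMemW2 n p φ)
    (hφl : LocallyIntegrableOn (fun y => φ (e'.symm y)) e'.target volume)
    (hηe' : tsupport η ⊆ e'.source) (hχe : tsupport χ ⊆ e.source) :
    ∫ y in e.target, η (e.symm y) * gradPairing γ e χ φ y =
      ∫ y in e'.target, η (e'.symm y) * gradPairing γ e' χ φ y := by
  have hae := ae_gradPairing_transition γ he he' hχ (fun e he i => (hφ e he).exists_first i) hφl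
  have hc := contDiffOn_transition he he'
  set τ := e.symm.trans e' with hτ
  have hsrc : τ.source = e.target ∩ e.symm ⁻¹' e'.source := by
    rw [hτ, OpenPartialHomeomorph.trans_source]
    rfl
  have htgt : τ.target = e'.target ∩ e'.symm ⁻¹' e.source := by
    rw [hτ, OpenPartialHomeomorph.trans_target]
    rfl
  rw [setIntegral_eq_of_subset_of_forall_sdiff_eq_zero (s := τ.source) e.open_target.measurableSet
      (hsrc ▸ inter_subset_left) fun y hy => ?_,
    setIntegral_eq_of_subset_of_forall_sdiff_eq_zero (s := τ.target) e'.open_target.measurableSet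
      (htgt ▸ inter_subset_left) fun y hy => ?_, setIntegral_target_eq hc]
  · refine integral_congr_ae ?_
    filter_upwards [hae, ae_restrict_mem τ.open_source.measurableSet] with y hy hys
    rw [hsrc] at hys
    have : e'.symm (τ y) = e.symm y := e'.left_inv hys.2
    rw [hy, this]
    ring
  · rw [gradPairing_eq_zero γ hy.1, mul_zero]
    exact fun h => hy.2 (htgt ▸ ⟨hy.1, hχe h⟩)
  · have h0 : η (e.symm y) = 0 :=
      image_eq_zero_of_notMem_tsupport fun h => hy.2 (hsrc ▸ ⟨hy.1, hηe' h⟩)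
    rw [h0, zero_mul]

/-- Weak form of the Laplace equation in a chart, tested with a function supported in its domain. -/
theorem setIntegral_laplacian_mul [T2Space M] (hn : 3 ≤ n) (hp : (n : ℝ) / 2 < p)
    (hγ : MetricMemW2 p γ) (hφ : ManifoldMemW2 n p φ) {F : M → ℝ} (hF : IsLaplacian γ φ F)
    (he : e ∈ atlas (EuclideanSpace ℝ (Fin n)) M) {χ : M → ℝ} (hχ : ContMDiff (𝓡 n) 𝓘(ℝ) ∞ χ)
    (hχc : HasCompactSupport χ) (hχe : tsupport χ ⊆ e.source) :
    IntegrableOn (fun y => √(metricComponents γ e y).det * F (e.symm y) * χ (e.symm y)) e.target ∧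
    ∫ y in e.target, √(metricComponents γ e y).det * F (e.symm y) * χ (e.symm y) =
      - ∫ y in e.target, gradPairing γ e χ φ y := by
  have hC : IsCompact (e '' tsupport χ) :=
    IsCompact.image_of_continuousOn hχc (e.continuousOn.mono hχe)
  have hCt : e '' tsupport χ ⊆ e.target := by
    rintro _ ⟨x, hx, rfl⟩
    exact e.map_source (hχe hx)
  have hout : ∀ y ∈ e.target, y ∉ e '' tsupport χ → e.symm y ∉ tsupport χ := fun y hy hyC h =>
    hyC ⟨_, h, e.right_inv hy⟩
  -- Extension by zero of `χ` read in the chart; it is smooth because its support is a compact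
  -- subset of the chart target.
  set ψ : EuclideanSpace ℝ (Fin n) → ℝ := e.target.indicator fun y => χ (e.symm y) with hψdef
  have hψe : ∀ y ∈ e.target, ψ y = χ (e.symm y) := fun y hy => indicator_of_mem hy _
  have hψev : ∀ y ∈ e.target, ψ =ᶠ[𝓝 y] fun y => χ (e.symm y) := fun y hy => by
    filter_upwards [e.open_target.mem_nhds hy] with z hz using hψe z hz
  have hψC : tsupport ψ ⊆ e '' tsupport χ := by
    refine closure_minimal (fun y hy => ?_) hC.isClosed
    by_contra hyC
    apply hy
    by_cases hyt : y ∈ e.target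
    · rw [hψe y hyt, image_eq_zero_of_notMem_tsupport (hout y hyt hyC)]
    · exact indicator_of_notMem hyt _
  have hψt := hψC.trans hCt
  have hψc : HasCompactSupport ψ := hC.of_isClosed_subset (isClosed_tsupport _) hψC
  have hψ : ContDiff ℝ ∞ ψ := contDiff_of_contDiffAt_tsupport fun y hy =>
    ((contDiffOn_comp_symm hχ he).contDiffAt
      (e.open_target.mem_nhds (hψt hy))).congr_of_eventuallyEq (hψev y (hψt hy))
  obtain ⟨h1, h3⟩ := setIntegral_sqrt_det_mul_coordLaplacian hn e.open_target hp
    (g := metricComponents γ e) (u := fun y => φ (e.symm y)) (continuousOn_metricComponents γ he)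
    (fun y _ => isSymm_metricComponents γ e y) (fun y hy => det_metricComponents_pos γ he hy)
    (hγ e he) (hφ e he) hψ hψc hψt
  have hz : ∀ f : EuclideanSpace ℝ (Fin n) → ℝ, ∀ y ∈ e.target \ tsupport ψ, f y * ψ y = 0 :=
    fun f y hy => by rw [image_eq_zero_of_notMem_tsupport hy.2, mul_zero]
  have hae : ∀ᵐ y ∂(volume.restrict e.target),
      √(metricComponents γ e y).det * coordLaplacian e.target (metricComponents γ e)
        (fun z => φ (e.symm z)) y * ψ y =
      √(metricComponents γ e y).det * F (e.symm y) * χ (e.symm y) := by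
    filter_upwards [hF e he, ae_restrict_mem e.open_target.measurableSet] with y hy hyt
    rw [hy, hψe y hyt]
  refine ⟨(h1.of_forall_sdiff_eq_zero e.open_target.measurableSet (hz _)).congr hae, ?_⟩
  rw [← integral_congr_ae hae, setIntegral_eq_of_subset_of_forall_sdiff_eq_zero
    e.open_target.measurableSet hψt (hz _), h3, neg_inj,
    setIntegral_eq_of_subset_of_forall_sdiff_eq_zero (s := tsupport ψ)
      (f := fun y => gradPairing γ e χ φ y) e.open_target.measurableSet hψt fun y hy => ?_]
  · refine setIntegral_congr_fun (isClosed_tsupport ψ).measurableSet fun y hy => ?_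
    rw [gradPairing_eq_sum, (hψev y (hψt hy)).fderiv_eq]
  · rw [gradPairing_eq_sum, ← (hψev y hy.1).fderiv_eq,
      fderiv_apply_eq_zero_of_notMem_tsupport hy.2]
    simp

/-- On a compact manifold, a function whose Laplacian has a sign has vanishing Laplacian: every
nonempty open set contains a nonempty open coordinate domain on which this holds. -/
theorem exists_open_laplacian_eq_zero [T2Space M] [CompactSpace M] (hn : 3 ≤ n)
    (hp : (n : ℝ) / 2 < p) (hγ : MetricMemW2 p γ) (hφ : ManifoldMemW2 n p φ) {F : M → ℝ}
    (hF : IsLaplacian γ φ F) {s : ℝ} (hs : s ≠ 0) (hsF : ManifoldAE n fun x : M => 0 ≤ s * F x)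
    {U : Set M} (hU : IsOpen U) (hUne : U.Nonempty) :
    ∃ e ∈ atlas (EuclideanSpace ℝ (Fin n)) M, ∃ V ⊆ e.target, IsOpen V ∧ V.Nonempty ∧
      (∀ y ∈ V, e.symm y ∈ U) ∧ ∀ᵐ y ∂(volume.restrict V), F (e.symm y) = 0 := by
  classical
  obtain ⟨t, -, ht⟩ := (isCompact_univ (X := M)).elim_nhds_subcover
    (fun x => (chartAt (EuclideanSpace ℝ (Fin n)) x).source)
    fun x _ => chart_source_mem_nhds _ x
  set c : t → OpenPartialHomeomorph M (EuclideanSpace ℝ (Fin n)) :=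
    fun i => chartAt (EuclideanSpace ℝ (Fin n)) (i : M)
  have hc : ∀ i, c i ∈ atlas (EuclideanSpace ℝ (Fin n)) M := fun i => chart_mem_atlas _ _
  obtain ⟨f, hf⟩ := SmoothPartitionOfUnity.exists_isSubordinate (𝓡 n) (isClosed_univ (X := M))
    (fun i : t => (c i).source) (fun i => (c i).open_source) (by
      intro x hx
      obtain ⟨i, hi, hxi⟩ := mem_iUnion₂.1 (ht hx)
      exact mem_iUnion.2 ⟨⟨i, hi⟩, hxi⟩)
  have hsum : ∀ x, ∑ i, f i x = 1 := by
    intro x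
    rw [← finsum_eq_sum_of_fintype]
    exact f.sum_eq_one (mem_univ x)
  have hsm : ∀ i, ContMDiff (𝓡 n) 𝓘(ℝ) ∞ (f i) := fun i => (f i).contMDiff
  have hcs : ∀ i, HasCompactSupport (f i) := fun i => HasCompactSupport.of_compactSpace _
  -- Local integrability is part of having a weak derivative, so any index serves; `0` exists as `n
  -- ≥ 3`.
  have hφl : ∀ e ∈ atlas (EuclideanSpace ℝ (Fin n)) M,
      LocallyIntegrableOn (fun y => φ (e.symm y)) e.target volume := fun e he =>
    (isWeakPartial_weakPartial ((hφ e he).exists_first ⟨0, by omega⟩)).1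
  have hL := fun i => setIntegral_laplacian_mul γ hn hp hγ hφ hF (hc i) (hsm i) (hcs i) (hf i)
  set I : t → ℝ := fun i => ∫ y in (c i).target,
    √(metricComponents γ (c i) y).det * F ((c i).symm y) * f i ((c i).symm y)
  -- The divergence theorem: insert `∑ fⱼ = 1`, move the `(i, j)` term to the chart `j`, and sum
  -- over `i` first, where `∑ ∇fᵢ = 0`.
  have hI : ∑ i, I i = 0 := by
    have h1 : ∀ i, I i = - ∑ j, ∫ y in (c j).target,
        f j ((c j).symm y) * gradPairing γ (c j) (f i) φ y := by
      intro i
      have h2 : ∀ j, ∫ y in (c j).target, f j ((c j).symm y) * gradPairing γ (c j) (f i) φ y =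
          ∫ y in (c i).target, f j ((c i).symm y) * gradPairing γ (c i) (f i) φ y := fun j =>
        (setIntegral_mul_gradPairing_transition γ (hc i) (hc j) (hsm i) hφ (hφl _ (hc j))
          (hf j) (hf i)).symm
      simp only [h2]
      rw [← integral_finsetSum _ fun j _ => integrableOn_mul_gradPairing γ (hc i)
        (hsm j).continuous (hsm i) hφ (hcs i) (hf i) fun x hx => Or.inr hx]
      simp only [I, (hL i).2, ← Finset.sum_mul, hsum, one_mul]
    simp only [h1, Finset.sum_neg_distrib, neg_eq_zero]
    rw [Finset.sum_comm]
    refine Finset.sum_eq_zero fun j _ => ?_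
    rw [← integral_finsetSum _ fun i _ => integrableOn_mul_gradPairing γ (hc j)
      (hsm j).continuous (hsm i) hφ (hcs j) (hf j) fun x hx =>
        Or.inl (image_eq_zero_of_notMem_tsupport hx)]
    refine setIntegral_eq_zero_of_forall_eq_zero fun y hy => ?_
    rw [← Finset.mul_sum]
    refine mul_eq_zero_of_right _ ?_
    have hd : ∀ i, DifferentiableAt ℝ (fun z => f i ((c j).symm z)) y := fun i =>
      ((contDiffOn_comp_symm (hsm i) (hc j)).contDiffAt
        ((c j).open_target.mem_nhds hy)).differentiableAt (by simp)
    have hdsum : ∀ k, ∑ i, fderiv ℝ (fun z => f i ((c j).symm z)) y k = 0 := by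
      intro k
      rw [← _root_.sum_apply, ← fderiv_fun_sum fun i _ => hd i]
      have h1 : (fun z => ∑ i, f i ((c j).symm z)) = fun _ => 1 := funext fun z => hsum _
      rw [h1, fderiv_fun_const]
      rfl
    simp only [gradPairing]
    rw [← Finset.mul_sum, ← sum_dotProduct]
    have : (∑ i, fun k => fderiv ℝ (fun z => f i ((c j).symm z)) y
        (EuclideanSpace.single k 1)) = 0 := by
      ext k
      rw [Finset.sum_apply]
      exact hdsum _
    rw [this, zero_dotProduct, mul_zero]
  have hnn : ∀ i, ∀ᵐ y ∂(volume.restrict (c i).target),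
      0 ≤ s * (√(metricComponents γ (c i) y).det * F ((c i).symm y) * f i ((c i).symm y)) := by
    intro i
    filter_upwards [hsF (c i) (hc i)] with y hy
    have := mul_nonneg (mul_nonneg (Real.sqrt_nonneg (metricComponents γ (c i) y).det) hy)
      (f.nonneg i ((c i).symm y))
    linarith
  -- Nonnegative integrals with zero sum vanish one by one; hence so do their nonnegative integrands
  -- almost everywhere.
  have hI0 : ∀ i, ∫ y in (c i).target,
      s * (√(metricComponents γ (c i) y).det * F ((c i).symm y) * f i ((c i).symm y)) = 0 := by
    have h1 : ∀ i, ∫ y in (c i).target,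
        s * (√(metricComponents γ (c i) y).det * F ((c i).symm y) * f i ((c i).symm y)) =
        s * I i := fun i => integral_const_mul _ _
    have h2 : ∑ i, s * I i = 0 := by rw [← Finset.mul_sum, hI, mul_zero]
    rw [Finset.sum_eq_zero_iff_of_nonneg fun i _ => (h1 i) ▸ integral_nonneg_of_ae (hnn i)] at h2
    exact fun i => (h1 i).trans (h2 i (Finset.mem_univ i))
  have hzero : ∀ i, ∀ᵐ y ∂(volume.restrict (c i).target),
      F ((c i).symm y) * f i ((c i).symm y) = 0 := by
    intro i
    have h1 := (integral_eq_zero_iff_of_nonneg_ae (hnn i) ((hL i).1.const_mul s)).1 (hI0 i)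
    filter_upwards [h1, ae_restrict_mem (c i).open_target.measurableSet] with y hy hyt
    have hd := (Real.sqrt_pos.2 (det_metricComponents_pos γ (hc i) hyt)).ne'
    simp only [Pi.zero_apply, mul_assoc] at hy
    exact ((mul_eq_zero.1 ((mul_eq_zero.1 hy).resolve_left hs)).resolve_left hd)
  obtain ⟨x, hx⟩ := hUne
  -- Where some `f i` is nonzero it can be cancelled from `F · f i = 0`; this determines the chart
  -- and the set `V`.
  obtain ⟨i, hi⟩ : ∃ i, f i x ≠ 0 := by
    by_contra! h
    have := hsum x
    simp [h] at this
  have hxs : x ∈ (c i).source := hf i (subset_tsupport _ hi)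
  have hWo : IsOpen (U ∩ {x | f i x ≠ 0}) :=
    hU.inter (isOpen_ne_fun (hsm i).continuous continuous_const)
  refine ⟨c i, hc i, (c i).target ∩ (c i).symm ⁻¹' (U ∩ {x | f i x ≠ 0}), inter_subset_left,
    (c i).isOpen_inter_preimage_symm hWo, ⟨c i x, (c i).map_source hxs, ?_⟩,
    fun y hy => hy.2.1, ?_⟩
  · rw [mem_preimage, (c i).left_inv hxs]
    exact ⟨hx, hi⟩
  · have h1 := ae_restrict_of_ae_restrict_of_subset
      (s := (c i).target ∩ (c i).symm ⁻¹' (U ∩ {x | f i x ≠ 0})) inter_subset_left (hzero i)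
    filter_upwards [h1, ae_restrict_mem ((c i).isOpen_inter_preimage_symm hWo).measurableSet]
      with y hy hyV
    exact (mul_eq_zero.1 hy).resolve_right hyV.2.2

end GradientPairing

/-! ### Nonexistence from the sign of the right-hand side -/

theorem theorem4p8 {n : ℕ} (hn : 3 ≤ n) {M : Type*} [TopologicalSpace M] [T2Space M]
    [CompactSpace M] [ChartedSpace (EuclideanSpace ℝ (Fin n)) M] [IsManifold (𝓡 n) ∞ M]
    {p : ℝ} (hp : (n : ℝ) / 2 < p)
    (γ : ContinuousRiemannianMetric (EuclideanSpace ℝ (Fin n))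
      (fun x : M => TangentSpace (𝓡 n) x))
    (hγ : MetricMemW2 p γ)
    (R : M → ℝ) (hR : IsScalarCurvature γ R)
    (r a q₁ q₂ b : M → ℝ)
    (hr : ∀ x, r x = ((n : ℝ) - 2) / (4 * ((n : ℝ) - 1)) * R x)
    (ha : ManifoldMemL1 n a) (hq₁ : ManifoldMemL1 n q₁) (hq₂ : ManifoldMemL1 n q₂)
    (hb : ManifoldMemL1 n b)
    (ha0 : ManifoldAE n (fun x : M => 0 ≤ a x)) (hq₁0 : ManifoldAE n (fun x : M => 0 ≤ q₁ x))
    (hq₂0 : ManifoldAE n (fun x : M => 0 ≤ q₂ x)) (hb0 : ManifoldAE n (fun x : M => 0 ≤ b x))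
    (hcase :
      (ManifoldAE n (fun x : M => r x ≤ 0) ∧ ManifoldAE n (fun x : M => b x - q₂ x ≤ 0) ∧
        ManifoldNotIdenticallyZero n (fun x : M => -r x + a x + q₁ x - b x + q₂ x)) ∨
      (ManifoldAE n (fun x : M => 0 ≤ r x) ∧ ManifoldAE n (fun x : M => a x = 0) ∧
        ManifoldAE n (fun x : M => q₁ x = 0) ∧ ManifoldAE n (fun x : M => 0 ≤ b x - q₂ x) ∧
        ManifoldNotIdenticallyZero n (fun x : M => r x + b x - q₂ x))) :
    ¬ ∃ φ : M → ℝ, ManifoldMemW2 n p φ ∧ ManifoldAE n (fun x : M => 0 < φ x) ∧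
      SatisfiesLichnerowicz γ r a q₁ q₂ b φ := by
  rintro ⟨φ, hφ, hφ0, hF⟩
  have hfalse : ∀ {V : Set (EuclideanSpace ℝ (Fin n))}, IsOpen V → V.Nonempty →
      ¬ ∀ᵐ y ∂(volume.restrict V), False := fun {V} hV hne h => by
    rw [ae_iff] at h
    simp only [not_false_eq_true, ofPred_true, Measure.restrict_apply_univ] at h
    exact (hV.measure_pos volume hne).ne' h
  rcases hcase with ⟨hr0, hbq, U, hU, hUne, c, hc, hcU⟩ |
    ⟨hr0, haz, hqz, hbq, U, hU, hUne, c, hc, hcU⟩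
  -- First case: all four terms are nonpositive, whence the sign `s = -1`.
  · obtain ⟨e, he, V, hVt, hV, hVne, hVU, hFV⟩ := exists_open_laplacian_eq_zero γ hn hp hγ hφ hF
      (s := -1) (by norm_num) (fun e he => by
        filter_upwards [hφ0 e he, ha0 e he, hq₁0 e he, hr0 e he, hbq e he] with y h1 h2 h3 h4 h5
        have e1 := mul_nonneg_of_nonpos_of_nonpos h4 (neg_nonpos.2 h1.le)
        have e2 := mul_nonneg h2 (Real.rpow_pos_of_pos h1 (-((3 * (n : ℝ) - 2) / ((n : ℝ) - 2)))).le
        have e3 := mul_nonneg h3 (Real.rpow_pos_of_pos h1 (-((n : ℝ) / ((n : ℝ) - 2)))).le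
        have e4 := mul_nonpos_of_nonpos_of_nonneg h5
          (Real.rpow_pos_of_pos h1 (((n : ℝ) + 2) / ((n : ℝ) - 2))).le
        linarith) hU hUne
    refine hfalse hV hVne ?_
    have hres : ∀ {P : M → Prop}, ManifoldAE n P → ∀ᵐ y ∂(volume.restrict V), P (e.symm y) :=
      fun hP => ae_restrict_of_ae_restrict_of_subset hVt (hP e he)
    filter_upwards [hres hφ0, hres ha0, hres hq₁0, hres hr0, hres hbq, hres hcU, hFV,
      ae_restrict_mem hV.measurableSet] with y h1 h2 h3 h4 h5 h6 h7 h8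
    have p2 := Real.rpow_pos_of_pos h1 (-((3 * (n : ℝ) - 2) / ((n : ℝ) - 2)))
    have p3 := Real.rpow_pos_of_pos h1 (-((n : ℝ) / ((n : ℝ) - 2)))
    have p4 := Real.rpow_pos_of_pos h1 (((n : ℝ) + 2) / ((n : ℝ) - 2))
    have e1 := mul_nonpos_of_nonpos_of_nonneg h4 h1.le
    have e2 := mul_nonneg h2 p2.le
    have e3 := mul_nonneg h3 p3.le
    have e4 := mul_nonpos_of_nonpos_of_nonneg h5 p4.le
    -- Nonpositive terms with zero sum are all zero, and the positive powers of `φ` cancel. The four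
    -- coefficients then vanish at a point where their signed sum is at least `c > 0`.
    have z1 := (mul_eq_zero.1 (show _ = (0 : ℝ) by linarith :
      r (e.symm y) * φ (e.symm y) = 0)).resolve_right h1.ne'
    have z2 := (mul_eq_zero.1 (le_antisymm (by linarith) e2)).resolve_right p2.ne'
    have z3 := (mul_eq_zero.1 (le_antisymm (by linarith) e3)).resolve_right p3.ne'
    have z4 := (mul_eq_zero.1 (le_antisymm e4 (by linarith))).resolve_right p4.ne'
    have := h6 (hVU y h8)
    linarith
  -- Second case: with `a` and `q₁` zero, the two remaining terms are nonnegative.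
  · obtain ⟨e, he, V, hVt, hV, hVne, hVU, hFV⟩ := exists_open_laplacian_eq_zero γ hn hp hγ hφ hF
      (s := 1) (by norm_num) (fun e he => by
        filter_upwards [hφ0 e he, haz e he, hqz e he, hr0 e he, hbq e he] with y h1 h2 h3 h4 h5
        have e1 := mul_nonneg h4 h1.le
        have e4 := mul_nonneg h5 (Real.rpow_pos_of_pos h1 (((n : ℝ) + 2) / ((n : ℝ) - 2))).le
        rw [h2, h3]
        linarith) hU hUne
    refine hfalse hV hVne ?_
    have hres : ∀ {P : M → Prop}, ManifoldAE n P → ∀ᵐ y ∂(volume.restrict V), P (e.symm y) :=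
      fun hP => ae_restrict_of_ae_restrict_of_subset hVt (hP e he)
    filter_upwards [hres hφ0, hres haz, hres hqz, hres hr0, hres hbq, hres hcU, hFV,
      ae_restrict_mem hV.measurableSet] with y h1 h2 h3 h4 h5 h6 h7 h8
    have p4 := Real.rpow_pos_of_pos h1 (((n : ℝ) + 2) / ((n : ℝ) - 2))
    have e1 := mul_nonneg h4 h1.le
    have e4 := mul_nonneg h5 p4.le
    rw [h2, h3] at h7
    have z1 := (mul_eq_zero.1 (le_antisymm (by linarith) e1)).resolve_right h1.ne'
    have z4 := (mul_eq_zero.1 (le_antisymm (by linarith) e4)).resolve_right p4.ne'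
    have := h6 (hVU y h8)
    linarith

end
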